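/- **Definitions.** A family $\Lambda=\{\lambda_n\}$ of real numbers is *uniformly discrete* if $\inf_{m\neq n}|\lambda_m-\lambda_n|>0$. A system of vectors $\{u_n\}$ in a Hilbert space $H$ is a *(QF)-system* ("quasi-frame") if (i) for every $q>2$ there is a constant $C(q)$ such that for every $f\in H$ and every $\varepsilon>0$ there is a finite linear combination $Q=\sum c_n u_n$ with $$\|f-Q\|<\varepsilon\qquad\text{and}\qquad \Big(\sum|c_n|^q\Big)^{1/q}\le C(q)\,\|f\|;$$ (ii) (Bessel inequality) there is a constant $C'$ such that $\big(\sum|\langle f,u_n\rangle|^2\big)^{1/2}\le C'\|f\|$ for all $f\in H$. It is a *frame* if there are constants $A>0$ and $B$ such that $A\|f\|^2\le\sum|\langle f,u_n\rangle|^2\le B\|f\|^2$ for all $f\in H$. **Theorem 1.** There exist a uniformly discrete sequence $\Lambda=\{\lambda_n\}_{n\in\mathbb{N}}$ of real numbers and a (complex-valued) function $g\in L^2(\mathbb{R})$ such that the family of translates $\{g(t-\lambda)\}_{\lambda\in\Lambda}$ is a (QF)-system for $L^2(\mathbb{R})$. In contrast, for no uniformly discrete $\Lambda\subset\mathbb{R}$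 and no $g\in L^2(\mathbb{R})$ is the family $\{g(t-\lambda)\}_{\lambda\in\Lambda}$ a frame for $L^2(\mathbb{R})$. -/

import Mathlib

open MeasureTheory

noncomputable section

/-- A family of reals is uniformly discrete if its members with different indices are at distance
at least some fixed `δ > 0` from each other. -/
def IsUniformlyDiscrete {ι : Type*} (Λ : ι → ℝ) : Prop :=
  ∃ δ : ℝ, 0 < δ ∧ ∀ m n : ι, m ≠ n → δ ≤ |Λ m - Λ n|

/-- The translate `t ↦ g (t - a)` of `g ∈ L²(ℝ)`, as an element of `L²(ℝ)`. -/
def translateL2 (a : ℝ) (g : Lp ℂ 2 (volume : Measure ℝ)) : Lp ℂ 2 (volume : Measure ℝ) :=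
  Lp.compMeasurePreserving (fun t : ℝ => t - a) (measurePreserving_sub_right volume a) g

section Hilbert

variable {H : Type*} [NormedAddCommGroup H] [InnerProductSpace ℂ H] {ι : Type*}

/-- Completeness with `ℓ_q` estimate of the coefficients, for one exponent `q`: finite linear
combinations `∑ cₙ uₙ` approximate every `f` arbitrarily well under the bound
`‖c‖_{ℓ_q} ≤ C ‖f‖`, with `C` independent of `f` and of the error `ε`. -/
def IsCompleteWithEstimate (u : ι → H) (q : ℝ) : Prop :=
  ∃ C : ℝ, ∀ f : H, ∀ ε : ℝ, 0 < ε → ∃ c : ι →₀ ℂ,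
    ‖f - c.sum (fun n a => a • u n)‖ < ε ∧
      (c.sum (fun _ a => ‖a‖ ^ q)) ^ (1 / q) ≤ C * ‖f‖

/-- Bessel inequality. -/
def IsBessel (u : ι → H) : Prop :=
  ∃ C : ℝ, ∀ f : H, Summable (fun n => ‖inner ℂ (u n) f‖ ^ 2) ∧
    Real.sqrt (∑' n, ‖inner ℂ (u n) f‖ ^ 2) ≤ C * ‖f‖

/-- (QF)-systems ("quasi-frames"). -/
def IsQuasiFrame (u : ι → H) : Prop :=
  (∀ q : ℝ, 2 < q → IsCompleteWithEstimate u q) ∧ IsBessel u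

/-- Frames: two-sided frame inequality. -/
def IsHilbertFrame (u : ι → H) : Prop :=
  ∃ A B : ℝ, 0 < A ∧ ∀ f : H, Summable (fun n => ‖inner ℂ (u n) f‖ ^ 2) ∧
    A * ‖f‖ ^ 2 ≤ ∑' n, ‖inner ℂ (u n) f‖ ^ 2 ∧
    ∑' n, ‖inner ℂ (u n) f‖ ^ 2 ≤ B * ‖f‖ ^ 2

end Hilbert

end

/-!
The Fourier transform turns translates of `g` into products of `𝓕 g` with characters. For small
`b`, the polynomials `(√(1 - 2b²) - 2b cos (2πx))²` are nonnegative with mean value one. A Riesz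
product of `N` of them, with rapidly growing frequencies, has the form `1 - p` with `p` free of low
frequencies. The `ℓ_q` norm of the coefficients of `p` is small when `N b ^ q` is small, whereas the
square root of the product has mean value at most `exp (-N b²)`. So along suitable `N → ∞` and
`b → 0`, which serve all `q > 2` at once, the polynomials `p` tend to one almost everywhere. Once
`𝓕 g` is damped by a weight that makes the convergence dominated, `p 𝓕 g` tends to `𝓕 g` in `L²`.
Thus every `𝓕 g e_s` has approximations with arbitrarily high frequencies and small coefficients.
They extend to all of `L²` by linearity and density, and countably many of them can be placed in
disjoint blocks of one uniformly discrete set.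

If `𝓕 g` is a bounded multiple of a Gaussian, the Bessel inequality follows from the Gaussian decay
of the Gram matrix. For a uniformly discrete family and any `g`, test the lower frame inequality on
the functions with Fourier transform `exp (-2π (x - N)²)`. Moving one Gaussian factor over to `𝓕 g`
and applying the Bessel inequality for Gaussians bounds the sum by
`K ‖exp (-π (x - N)²) 𝓕 g‖²`, which tends to zero as `N → ∞`.
-/

noncomputable section

open Filter Topology Real
open scoped FourierTransform SchwartzMap ComplexConjugate ComplexOrder LaurentPolynomial ENNReal

section QSum

variable {ι : Type*} {q : ℝ}

/-- The `q`-th power `∑ |cₙ|^q` of the `ℓ_q` norm of a finitely supported family. -/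
def qsum (q : ℝ) (c : ι →₀ ℂ) : ℝ := c.sum fun _ a => ‖a‖ ^ q

lemma qsum_nonneg (c : ι →₀ ℂ) : 0 ≤ qsum q c :=
  Finset.sum_nonneg fun _ _ => by positivity

lemma qsum_add_of_disjoint {c d : ι →₀ ℂ} (h : Disjoint c.support d.support) :
    qsum q (c + d) = qsum q c + qsum q d :=
  Finsupp.sum_add_index_of_disjoint h _

lemma qsum_single (hq : q ≠ 0) (i : ι) (a : ℂ) : qsum q (Finsupp.single i a) = ‖a‖ ^ q :=
  Finsupp.sum_single_index (by rw [norm_zero, Real.zero_rpow hq])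

lemma qsum_neg (c : ι →₀ ℂ) : qsum q (-c) = qsum q c := by
  simp only [qsum, Finsupp.sum, Finsupp.support_neg, Finsupp.neg_apply, norm_neg]

lemma qsum_smul (hq : q ≠ 0) (b : ℂ) (c : ι →₀ ℂ) : qsum q (b • c) = ‖b‖ ^ q * qsum q c := by
  unfold qsum
  rw [Finsupp.sum_smul_index' fun _ => by rw [norm_zero, Real.zero_rpow hq], Finsupp.mul_sum]
  refine Finsupp.sum_congr fun i _ => ?_
  rw [smul_eq_mul, norm_mul, Real.mul_rpow (norm_nonneg _) (norm_nonneg _)]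

lemma qsum_mapDomain {κ : Type*} {e : ι → κ} (he : e.Injective) (c : ι →₀ ℂ) :
    qsum q (c.mapDomain e) = qsum q c :=
  Finsupp.sum_mapDomain_index_inj he

lemma norm_rpow_le_qsum {c : ι →₀ ℂ} {i : ι} (hi : i ∈ c.support) : ‖c i‖ ^ q ≤ qsum q c :=
  Finset.single_le_sum (f := fun i => ‖c i‖ ^ q) (fun _ _ => by positivity) hi

lemma qsum_anti {p : ℝ} (hp : 0 < p) (hpq : p ≤ q) {c : ι →₀ ℂ} (hc : qsum p c ≤ 1) :
    qsum q c ≤ qsum p c := by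
  refine Finset.sum_le_sum fun i hi => ?_
  have hci : ‖c i‖ ≤ 1 := by
    by_contra! h
    exact (Real.one_lt_rpow h hp).not_ge ((norm_rpow_le_qsum hi).trans hc)
  exact Real.rpow_le_rpow_of_exponent_ge (norm_pos_iff.2 (Finsupp.mem_support_iff.1 hi)) hci hpq

end QSum

section Character

/-- The character `x ↦ exp (-2πi a x)`, by which the Fourier transform of a function is multiplied
when the function is translated by `a`. -/
def modChar (a x : ℝ) : ℂ := Real.fourierChar (-(a * x))

lemma norm_modChar (a x : ℝ) : ‖modChar a x‖ = 1 := Circle.norm_coe _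

lemma modChar_add (a b x : ℝ) : modChar (a + b) x = modChar a x * modChar b x := by
  simp only [modChar]
  rw [← Circle.coe_mul, ← AddChar.map_add_eq_mul]
  ring_nf

lemma modChar_zero (x : ℝ) : modChar 0 x = 1 := by simp [modChar]

lemma modChar_eq_exp (a x : ℝ) : modChar a x = Complex.exp (-2 * π * a * Complex.I * x) := by
  simp only [modChar, Real.fourierChar_apply]
  push_cast
  ring_nf

lemma modChar_add_modChar_neg (a x : ℝ) :
    modChar a x + modChar (-a) x = ((2 * Real.cos (2 * π * a * x) : ℝ) : ℂ) := by
  simp only [modChar_eq_exp, Complex.ofReal_mul, Complex.ofReal_cos, Complex.ofReal_ofNat,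
    Complex.ofReal_neg, Complex.two_cos]
  ring_nf

lemma star_modChar (a x : ℝ) : star (modChar a x) = modChar (-a) x := by
  simp [modChar]

lemma continuous_modChar (a : ℝ) : Continuous (modChar a) := by
  unfold modChar
  fun_prop

lemma integral_modChar_intCast (n : ℤ) (k : ℝ) :
    ∫ x in k..k + 1, modChar n x = if n = 0 then 1 else 0 := by
  split_ifs with hn
  · simp [hn, modChar_zero]
  · have hc : (-2 * π * n * Complex.I : ℂ) ≠ 0 := by simp [hn, pi_ne_zero]
    simp only [modChar_eq_exp, Complex.ofReal_intCast]
    rw [integral_exp_mul_complex hc, div_eq_zero_iff, sub_eq_zero]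
    refine Or.inl (Complex.exp_eq_exp_iff_exists_int.2 ⟨-n, ?_⟩)
    push_cast
    ring

end Character

section TrigPoly

open LaurentPolynomial

/-- The trigonometric polynomial `∑ pₙ exp (-2πi n x)`, that is, the Laurent polynomial `p` at the
point `exp (-2πi x)` of the unit circle. -/
def trigPoly (x : ℝ) : ℂ[T;T⁻¹] →+* ℂ :=
  eval₂ (RingHom.id ℂ) (Circle.toUnits (Real.fourierChar (-x)))

lemma trigPoly_T (x : ℝ) (n : ℤ) : trigPoly x (T n) = modChar n x := by
  rw [trigPoly, eval₂_T, ← map_zpow, modChar, ← AddChar.map_zsmul_eq_zpow]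
  simp

lemma trigPoly_C_mul_T (x : ℝ) (a : ℂ) (n : ℤ) : trigPoly x (C a * T n) = a * modChar n x := by
  rw [map_mul, trigPoly_T, trigPoly, eval₂_C, RingHom.id_apply]

lemma continuous_trigPoly (p : ℂ[T;T⁻¹]) : Continuous fun x => trigPoly x p := by
  induction p using LaurentPolynomial.induction_on' with
  | add p r hp hr => simpa only [map_add] using Continuous.fun_add hp hr
  | C_mul_T n a =>
    simp only [trigPoly_C_mul_T]
    exact continuous_const.mul (continuous_modChar n)

lemma integral_trigPoly (p : ℂ[T;T⁻¹]) (k : ℝ) :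
    ∫ x in k..k + 1, trigPoly x p = p.coeff 0 := by
  induction p using LaurentPolynomial.induction_on' with
  | add p r hp hr =>
    simp only [map_add, AddMonoidAlgebra.coeff_add, Finsupp.add_apply]
    rw [intervalIntegral.integral_add ((continuous_trigPoly p).intervalIntegrable _ _)
      ((continuous_trigPoly r).intervalIntegrable _ _), hp, hr]
  | C_mul_T n a =>
    simp only [trigPoly_C_mul_T]
    rw [intervalIntegral.integral_const_mul, integral_modChar_intCast, ← single_eq_C_mul_T,
      AddMonoidAlgebra.coeff_single, Finsupp.single_apply, mul_ite, mul_one, mul_zero]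

/-- The Laurent polynomial `p (zⁿ)`, which carries the frequencies of a factor of a Riesz product
away from those of the preceding factors. -/
def dilate (n : ℤ) : ℂ[T;T⁻¹] →+* ℂ[T;T⁻¹] :=
  AddMonoidAlgebra.mapDomainRingHom ℂ (zmultiplesHom ℤ n)

lemma dilate_C_mul_T (n : ℤ) (a : ℂ) (m : ℤ) : dilate n (C a * T m) = C a * T (m * n) := by
  simp [dilate, ← single_eq_C_mul_T]

lemma trigPoly_dilate (n : ℤ) (p : ℂ[T;T⁻¹]) (x : ℝ) :
    trigPoly x (dilate n p) = trigPoly (n * x) p := by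
  induction p using LaurentPolynomial.induction_on' with
  | add p r hp hr => simp only [map_add, hp, hr]
  | C_mul_T m a =>
    rw [dilate_C_mul_T, trigPoly_C_mul_T, trigPoly_C_mul_T]
    simp only [modChar, Int.cast_mul, mul_assoc]

lemma exists_mem_support_of_mem_support_mul_dilate {n m : ℤ} {c p : ℂ[T;T⁻¹]}
    (hm : m ∈ (c * dilate n p).coeff.support) :
    ∃ i ∈ c.coeff.support, ∃ j ∈ p.coeff.support, i + j * n = m := by
  obtain ⟨i, hi, k, hk, rfl⟩ := Finset.mem_add.1 (AddMonoidAlgebra.support_coeff_mul_subset _ _ hm)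
  obtain ⟨j, hj, rfl⟩ := Finset.mem_image.1 (Finsupp.mapDomain_support hk)
  exact ⟨i, hi, j, hj, rfl⟩

section Lacunary

variable {B n : ℤ} {c : ℂ[T;T⁻¹]} (hB : ∀ m ∈ c.coeff.support, |m| ≤ B) (hn : 2 * B < n)

include hB hn

lemma coeff_mul_dilate {i : ℤ} (hi : |i| ≤ B) (p : ℂ[T;T⁻¹]) (j : ℤ) :
    (c * dilate n p).coeff (i + j * n) = c.coeff i * p.coeff j := by
  induction p using LaurentPolynomial.induction_on' with
  | add p r hp hr =>
    simp only [map_add, mul_add, AddMonoidAlgebra.coeff_add, Finsupp.add_apply, hp, hr]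
  | C_mul_T k a =>
    rw [dilate_C_mul_T, ← single_eq_C_mul_T, ← single_eq_C_mul_T, AddMonoidAlgebra.coeff_single,
      AddMonoidAlgebra.coeff_mul_single_apply, Finsupp.single_apply]
    split_ifs with hkj
    · rw [hkj, add_neg_cancel_right]
    · suffices c.coeff (i + j * n + -(k * n)) = 0 by rw [this, zero_mul, mul_zero]
      by_contra h
      have hbound := abs_le.1 (hB _ (Finsupp.mem_support_iff.2 h))
      rw [abs_le] at hi
      rcases lt_or_gt_of_ne hkj with h | h <;> nlinarith

lemma qsum_mul_dilate (q : ℝ) (p : ℂ[T;T⁻¹]) :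
    qsum q (c * dilate n p).coeff = qsum q c.coeff * qsum q p.coeff := by
  have hcoeff {i j : ℤ} (hi : i ∈ c.coeff.support) :=
    coeff_mul_dilate hB hn (hB i hi) p j
  simp only [qsum, Finsupp.sum]
  rw [Finset.sum_mul_sum, ← Finset.sum_product']
  refine (Finset.sum_nbij (fun ij => ij.1 + ij.2 * n) ?_ ?_ ?_ ?_).symm
  · rintro ⟨i, j⟩ hij
    rw [Finset.mem_product] at hij
    rw [Finsupp.mem_support_iff, hcoeff hij.1]
    exact mul_ne_zero (Finsupp.mem_support_iff.1 hij.1) (Finsupp.mem_support_iff.1 hij.2)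
  · rintro ⟨i, j⟩ hij ⟨i', j'⟩ hij' h
    have hi := abs_le.1 (hB _ (Finset.mem_product.1 hij).1)
    have hi' := abs_le.1 (hB _ (Finset.mem_product.1 hij').1)
    dsimp only at h hi hi'
    rcases lt_trichotomy j j' with hj | rfl | hj
    · nlinarith
    · simpa using h
    · nlinarith
  · intro m hm
    obtain ⟨i, hi, j, hj, rfl⟩ := exists_mem_support_of_mem_support_mul_dilate hm
    exact ⟨(i, j), Finset.mem_product.2 ⟨hi, hj⟩, rfl⟩
  · rintro ⟨i, j⟩ hij
    rw [hcoeff (Finset.mem_product.1 hij).1, norm_mul,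
      Real.mul_rpow (norm_nonneg _) (norm_nonneg _)]

end Lacunary

lemma le_abs_of_mem_support_mul_dilate {B M n : ℤ} {c p : ℂ[T;T⁻¹]}
    (hB : ∀ m ∈ c.coeff.support, |m| ≤ B) (hn : M + B ≤ n)
    (hM : ∀ m ∈ c.coeff.support, m ≠ 0 → M ≤ |m|) {m : ℤ}
    (hm : m ∈ (c * dilate n p).coeff.support) (hm0 : m ≠ 0) : M ≤ |m| := by
  obtain ⟨i, hi, j, -, rfl⟩ := exists_mem_support_of_mem_support_mul_dilate hm
  rcases eq_or_ne j 0 with rfl | hj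
  · rw [zero_mul, add_zero] at hm0 ⊢
    exact hM i hi hm0
  · have hjn : n ≤ |j * n| := by
      rw [abs_mul]
      nlinarith [Int.one_le_abs hj, le_abs_self n, abs_nonneg n]
    have htri := abs_sub_abs_le_abs_sub (j * n) (-i)
    rw [abs_neg, sub_neg_eq_add, add_comm (j * n)] at htri
    linarith [hB i hi]

theorem exists_rieszProduct {s : ℂ[T;T⁻¹]} (hs : ∀ x, 0 ≤ trigPoly x s) (M : ℤ) (N : ℕ) :
    ∃ S : ℂ[T;T⁻¹], (∀ x, 0 ≤ trigPoly x S) ∧ S.coeff 0 = s.coeff 0 ^ N ∧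
      (S ^ 2).coeff 0 = (s ^ 2).coeff 0 ^ N ∧
      (∀ q ≠ 0, qsum q (S ^ 2).coeff = qsum q (s ^ 2).coeff ^ N) ∧
      ∀ m ∈ (S ^ 2).coeff.support, m ≠ 0 → M ≤ |m| := by
  induction N with
  | zero =>
    have hone : (1 : ℂ[T;T⁻¹]).coeff = Finsupp.single 0 1 := rfl
    refine ⟨1, fun x => ?_, ?_, ?_, fun q hq => ?_, fun m hm hm0 => ?_⟩
    · rw [map_one]
      exact zero_le_one
    · rw [hone, Finsupp.single_eq_same, pow_zero]
    · rw [one_pow, hone, Finsupp.single_eq_same, pow_zero]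
    · rw [one_pow, hone, qsum_single hq, norm_one, Real.one_rpow, pow_zero]
    · rw [one_pow, hone] at hm
      exact absurd (Finset.mem_singleton.1 (Finsupp.support_single_subset hm)) hm0
  | succ N ih =>
    obtain ⟨S, hS, hS0, hSS0, hSq, hSM⟩ := ih
    set B : ℤ := ∑ m ∈ S.coeff.support ∪ (S ^ 2).coeff.support, |m|
    have hB {m : ℤ} (hm : m ∈ S.coeff.support ∪ (S ^ 2).coeff.support) : |m| ≤ B :=
      Finset.single_le_sum (fun _ _ => abs_nonneg _) hm
    have hB₀ : |(0 : ℤ)| ≤ B := abs_zero.trans_le (Finset.sum_nonneg fun _ _ => abs_nonneg _)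
    have hB₁ : ∀ m ∈ S.coeff.support, |m| ≤ B := fun m hm => hB (Finset.mem_union_left _ hm)
    have hB₂ : ∀ m ∈ (S ^ 2).coeff.support, |m| ≤ B := fun m hm => hB (Finset.mem_union_right _ hm)
    obtain ⟨n, hn, hnM⟩ : ∃ n : ℤ, 2 * B < n ∧ M + B ≤ n :=
      ⟨max (2 * B + 1) (M + B), Int.lt_of_add_one_le (le_max_left _ _), le_max_right _ _⟩
    have hsq : (S * dilate n s) ^ 2 = S ^ 2 * dilate n (s ^ 2) := by rw [mul_pow, map_pow]
    refine ⟨S * dilate n s, fun x => ?_, ?_, ?_, fun q hq => ?_, fun m hm hm0 => ?_⟩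
    · rw [map_mul, trigPoly_dilate]
      exact mul_nonneg (hS _) (hs _)
    · simpa only [zero_add, zero_mul, hS0, pow_succ] using coeff_mul_dilate hB₁ hn hB₀ s 0
    · simpa only [hsq, zero_add, zero_mul, hSS0, pow_succ _ N] using
        coeff_mul_dilate hB₂ hn hB₀ (s ^ 2) 0
    · rw [hsq, qsum_mul_dilate hB₂ hn, hSq q hq, ← pow_succ]
    · rw [hsq] at hm
      exact le_abs_of_mem_support_mul_dilate hB₂ hnM hSM hm hm0

/-- The square root `√(1 - 2b²) - 2b cos (2πx)` of the factors of the Riesz products, normalized so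
that its square has mean value one. -/
def rieszFactor (b : ℝ) : ℂ[T;T⁻¹] := C (√(1 - 2 * b ^ 2) : ℂ) - C (b : ℂ) * (T 1 + T (-1))

section RieszFactor

variable {b : ℝ}

lemma rieszFactor_coeff_zero (b : ℝ) : (rieszFactor b).coeff 0 = √(1 - 2 * b ^ 2) := by
  simp [rieszFactor, mul_add, -single_eq_C_mul_T, ← single_eq_C]

lemma norm_rieszFactor_coeff_zero_le (b : ℝ) : ‖(rieszFactor b).coeff 0‖ ≤ rexp (-b ^ 2) := by
  rw [rieszFactor_coeff_zero, Complex.norm_of_nonneg (Real.sqrt_nonneg _),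
    Real.sqrt_le_left (Real.exp_pos _).le, ← Real.exp_nat_mul]
  convert Real.add_one_le_exp (-(2 * b ^ 2)) using 2
  · ring
  · push_cast
    ring

lemma trigPoly_rieszFactor_nonneg (hb : b ^ 2 ≤ 1 / 6) (x : ℝ) :
    0 ≤ trigPoly x (rieszFactor b) := by
  have hC (a : ℂ) : trigPoly x (C a) = a := eval₂_C _ _ a
  have heval : trigPoly x (rieszFactor b) =
      ((√(1 - 2 * b ^ 2) - 2 * b * Real.cos (2 * π * x) : ℝ) : ℂ) := by
    have hcos := modChar_add_modChar_neg 1 x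
    simp only [rieszFactor, map_sub, map_mul, map_add, trigPoly_T, hC, Int.cast_neg, Int.cast_one,
      hcos]
    push_cast
    ring_nf
  have hle : 2 * b * Real.cos (2 * π * x) ≤ √(1 - 2 * b ^ 2) := by
    refine Real.le_sqrt_of_sq_le ?_
    nlinarith [Real.cos_sq_le_one (2 * π * x), sq_nonneg b]
  rw [heval]
  exact_mod_cast sub_nonneg.2 hle

lemma coeff_rieszFactor_sq (hb : b ^ 2 ≤ 1 / 6) :
    (rieszFactor b ^ 2).coeff = Finsupp.single 0 1 +
      (Finsupp.single 1 (-2 * √(1 - 2 * b ^ 2) * b : ℂ) +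
      (Finsupp.single (-1) (-2 * √(1 - 2 * b ^ 2) * b : ℂ) +
      (Finsupp.single 2 (b ^ 2 : ℂ) + Finsupp.single (-2) (b ^ 2 : ℂ)))) := by
  have hsq : C (√(1 - 2 * b ^ 2) : ℂ) ^ 2 = 1 - 2 * C (b : ℂ) ^ 2 := by
    rw [← map_pow, ← Complex.ofReal_pow, Real.sq_sqrt (by linarith)]
    push_cast
    simp only [map_sub, map_mul, map_pow, map_one, map_ofNat]
  have hT : (T 1 * T (-1) : ℂ[T;T⁻¹]) = 1 := by rw [← T_add, add_neg_cancel, T_zero]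
  have hT₂ : (T 2 : ℂ[T;T⁻¹]) = T 1 * T 1 := by rw [← T_add, one_add_one_eq_two]
  have hT₂' : (T (-2) : ℂ[T;T⁻¹]) = T (-1) * T (-1) := by rw [← T_add]; rfl
  have hexp : rieszFactor b ^ 2 = C 1 * T 0 + (C (-2 * √(1 - 2 * b ^ 2) * b : ℂ) * T 1 +
      (C (-2 * √(1 - 2 * b ^ 2) * b : ℂ) * T (-1) + (C (b ^ 2 : ℂ) * T 2 +
      C (b ^ 2 : ℂ) * T (-2)))) := by
    simp only [rieszFactor, map_mul, map_neg, map_one, map_pow, map_ofNat, hT₂, hT₂', T_zero]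
    linear_combination hsq + 2 * C (b : ℂ) ^ 2 * hT
  rw [hexp]
  simp only [← single_eq_C_mul_T, AddMonoidAlgebra.coeff_add, AddMonoidAlgebra.coeff_single]

lemma rieszFactor_sq_coeff_zero (hb : b ^ 2 ≤ 1 / 6) : (rieszFactor b ^ 2).coeff 0 = 1 := by
  simp [coeff_rieszFactor_sq hb]

lemma qsum_rieszFactor_sq_le {q : ℝ} (hb0 : 0 ≤ b) (hb : b ^ 2 ≤ 1 / 6) (hq : 0 < q) :
    qsum q (rieszFactor b ^ 2).coeff ≤ 1 + 4 * (2 * b) ^ q := by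
  have hsupp : (rieszFactor b ^ 2).coeff.support ⊆ {0, 1, -1, 2, -2} := fun m hm => by
    contrapose! hm
    simp only [Finset.mem_insert, Finset.mem_singleton, not_or] at hm
    simp [coeff_rieszFactor_sq hb, hm]
  have : 0 ≤ 2 * √(1 - 2 * b ^ 2) * b := by positivity
  have hsum : qsum q (rieszFactor b ^ 2).coeff =
      1 + ((2 * √(1 - 2 * b ^ 2) * b) ^ q + ((2 * √(1 - 2 * b ^ 2) * b) ^ q +
        ((b ^ 2) ^ q + (b ^ 2) ^ q))) := by
    rw [qsum, Finsupp.sum_of_support_subset _ hsupp _ fun _ _ => by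
      rw [norm_zero, Real.zero_rpow hq.ne']]
    simp [coeff_rieszFactor_sq hb, abs_of_nonneg hb0, abs_of_nonneg (Real.sqrt_nonneg _)]
  have hfst : (2 * √(1 - 2 * b ^ 2) * b) ^ q ≤ (2 * b) ^ q := by
    have : √(1 - 2 * b ^ 2) ≤ 1 := Real.sqrt_le_one.2 (by linarith [sq_nonneg b])
    gcongr
    linarith
  have hsnd : (b ^ 2) ^ q ≤ (2 * b) ^ q := by
    gcongr
    nlinarith
  linarith

end RieszFactor

lemma integral_norm_trigPoly {p : ℂ[T;T⁻¹]} (hp : ∀ x, 0 ≤ trigPoly x p) (k : ℝ) :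
    ∫ x in k..k + 1, ‖trigPoly x p‖ = ‖p.coeff 0‖ := by
  have hcomplex : ((∫ x in k..k + 1, ‖trigPoly x p‖ : ℝ) : ℂ) = p.coeff 0 := by
    rw [← intervalIntegral.integral_ofReal, ← integral_trigPoly p k]
    simp only [Complex.norm_of_nonneg' (hp _)]
  rw [← hcomplex, Complex.norm_of_nonneg]
  exact intervalIntegral.integral_nonneg (le_add_of_nonneg_right zero_le_one)
    fun _ _ => norm_nonneg _

lemma coeff_one_sub {p : ℂ[T;T⁻¹]} (hp : p.coeff 0 = 1) : (1 - p).coeff = -p.coeff.erase 0 := by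
  change Finsupp.single 0 1 - p.coeff = _
  rw [← sub_add_cancel_left (Finsupp.single 0 1), ← hp, Finsupp.single_add_erase]

lemma qsum_one_sub {q : ℝ} (hq : q ≠ 0) {p : ℂ[T;T⁻¹]} (hp : p.coeff 0 = 1) :
    qsum q (1 - p).coeff = qsum q p.coeff - 1 := by
  have hdisj : Disjoint (Finsupp.single (0 : ℤ) (1 : ℂ)).support (p.coeff.erase 0).support :=
    Finset.disjoint_of_subset_left Finsupp.support_single_subset (by simp)
  have hsum := qsum_add_of_disjoint (q := q) hdisj
  rw [← hp, Finsupp.single_add_erase, hp, qsum_single hq, norm_one, Real.one_rpow] at hsum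
  rw [coeff_one_sub hp, qsum_neg, hsum, add_sub_cancel_left]

end TrigPoly

section AlmostEverywhere

variable {α E : Type*} [MeasurableSpace α] {μ : Measure α} [NormedAddCommGroup E]

lemma ae_tendsto_zero_of_summable_integral_norm {F : ℕ → α → E} (hF : ∀ j, Integrable (F j) μ)
    (hsum : Summable fun j => ∫ x, ‖F j x‖ ∂μ) :
    ∀ᵐ x ∂μ, Tendsto (fun j => F j x) atTop (𝓝 0) := by
  have hmeas (j : ℕ) : AEMeasurable (fun x => ‖F j x‖ₑ) μ := (hF j).aestronglyMeasurable.enorm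
  have hfin : ∫⁻ x, ∑' j, ‖F j x‖ₑ ∂μ ≠ ⊤ := by
    rw [lintegral_tsum hmeas]
    simpa only [ofReal_integral_norm_eq_lintegral_enorm (hF _)] using hsum.tsum_ofReal_ne_top
  filter_upwards [ae_lt_top' (AEMeasurable.tsum hmeas) hfin] with x hx
  exact tendsto_zero_iff_enorm_tendsto_zero.2 (ENNReal.tendsto_atTop_zero_of_tsum_ne_top hx.ne)

end AlmostEverywhere

section TrigPolyLimit

open LaurentPolynomial

lemma tendsto_four_pow_mul_rpow {q : ℝ} (hq : 2 < q) :
    Tendsto (fun j : ℕ => (4 : ℝ) ^ j * (j / 2 ^ j) ^ q) atTop (𝓝 0) := by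
  have hrate : 0 < (q - 2) * Real.log 2 := mul_pos (by linarith) (Real.log_pos one_lt_two)
  refine ((tendsto_rpow_mul_exp_neg_mul_atTop_nhds_zero q _ hrate).comp
    tendsto_natCast_atTop_atTop).congr fun j => ?_
  have htwo : (2 : ℝ) ^ j = rexp (j * Real.log 2) := by
    rw [mul_comm, Real.exp_mul, Real.exp_log two_pos, Real.rpow_natCast]
  have hfour : (4 : ℝ) ^ j = rexp (2 * (j * Real.log 2)) := by
    rw [show (4 : ℝ) = 2 ^ 2 by norm_num, ← pow_mul, mul_comm, pow_mul, htwo, ← Real.exp_nat_mul,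
      Nat.cast_ofNat]
  rw [Function.comp_apply, hfour, htwo, Real.div_rpow (Nat.cast_nonneg j) (Real.exp_pos _).le,
    ← Real.exp_mul, mul_div_left_comm, ← Real.exp_sub]
  ring_nf

lemma ae_tendsto_trigPoly_zero {S : ℕ → ℂ[T;T⁻¹]} (hS : ∀ j x, 0 ≤ trigPoly x (S j))
    (hsum : Summable fun j => ‖(S j).coeff 0‖) :
    ∀ᵐ x : ℝ, Tendsto (fun j => trigPoly x (S j)) atTop (𝓝 0) := by
  rw [← Measure.restrict_univ (μ := volume), ← iUnion_Ioc_intCast, ae_restrict_iUnion_iff]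
  intro k
  refine ae_tendsto_zero_of_summable_integral_norm
    (fun j => ((continuous_trigPoly (S j)).intervalIntegrable _ _).1) ?_
  simpa only [← intervalIntegral.integral_of_le (le_add_of_nonneg_right zero_le_one),
    integral_norm_trigPoly (hS _)] using hsum

/-- The size `b` of the oscillation in the `4 ^ j` factors of the `j`-th Riesz product:
`4 ^ j * b ^ 2` diverges, while `4 ^ j * b ^ q` tends to zero for all `q > 2` at once. -/
def rieszSize (j : ℕ) : ℝ := j / 2 ^ j / 4

lemma rieszSize_nonneg (j : ℕ) : 0 ≤ rieszSize j := by
  unfold rieszSize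
  positivity

lemma rieszSize_sq_le (j : ℕ) : rieszSize j ^ 2 ≤ 1 / 6 := by
  have hle : (j : ℝ) / 2 ^ j ≤ 1 :=
    div_le_one_of_le₀ (by exact_mod_cast Nat.lt_two_pow_self.le) (by positivity)
  have hnn : 0 ≤ (j : ℝ) / 2 ^ j := by positivity
  unfold rieszSize
  nlinarith

lemma norm_rieszFactor_coeff_zero_pow_le (j : ℕ) :
    ‖(rieszFactor (rieszSize j)).coeff 0‖ ^ 4 ^ j ≤ rexp (-(1 / 16) * (j : ℝ) ^ 2) := by
  have hpow : ((2 : ℝ) ^ j) ^ 2 = 4 ^ j := by rw [pow_right_comm]; norm_num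
  refine (pow_le_pow_left₀ (norm_nonneg _) (norm_rieszFactor_coeff_zero_le _) _).trans_eq ?_
  rw [← Real.exp_nat_mul]
  simp only [rieszSize, div_pow, hpow]
  push_cast
  field_simp
  norm_num

lemma qsum_rieszFactor_sq_pow_le {q : ℝ} (hq : 0 < q) (j : ℕ) :
    qsum q (rieszFactor (rieszSize j) ^ 2).coeff ^ 4 ^ j ≤
      rexp (4 * (4 ^ j * (j / 2 ^ j) ^ q)) := by
  have hsize : (2 * rieszSize j) ^ q ≤ (j / 2 ^ j) ^ q := by
    have hnn : 0 ≤ (j : ℝ) / 2 ^ j := by positivity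
    refine Real.rpow_le_rpow (mul_nonneg zero_le_two (rieszSize_nonneg j)) ?_ hq.le
    unfold rieszSize
    linarith
  have hfactor : qsum q (rieszFactor (rieszSize j) ^ 2).coeff ≤ rexp (4 * (j / 2 ^ j) ^ q) := by
    linarith [qsum_rieszFactor_sq_le (rieszSize_nonneg j) (rieszSize_sq_le j) hq,
      Real.add_one_le_exp (4 * ((j : ℝ) / 2 ^ j) ^ q)]
  refine (pow_le_pow_left₀ (qsum_nonneg _) hfactor _).trans_eq ?_
  rw [← Real.exp_nat_mul]
  push_cast
  ring_nf

theorem exists_trigPoly_tendsto_one : ∃ p : ℕ → ℂ[T;T⁻¹],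
    (∀ j, ∀ m ∈ (p j).coeff.support, (j : ℤ) ≤ |m|) ∧
      (∀ q, 2 < q → Tendsto (fun j => qsum q (p j).coeff) atTop (𝓝 0)) ∧
      ∀ᵐ x : ℝ, Tendsto (fun j => trigPoly x (p j)) atTop (𝓝 1) := by
  choose S hS hS0 hSS0 hSq hSM using fun j : ℕ =>
    exists_rieszProduct (trigPoly_rieszFactor_nonneg (rieszSize_sq_le j)) j (4 ^ j)
  replace hSS0 (j : ℕ) : (S j ^ 2).coeff 0 = 1 := by
    rw [hSS0, rieszFactor_sq_coeff_zero (rieszSize_sq_le j), one_pow]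
  have hSsum : Summable fun j => ‖(S j).coeff 0‖ := by
    simp only [hS0, norm_pow]
    exact (Real.summable_exp_nat_mul_of_ge (by norm_num) fun j : ℕ => by
      exact_mod_cast Nat.le_self_pow two_ne_zero j).of_nonneg_of_le
        (fun _ => by positivity) norm_rieszFactor_coeff_zero_pow_le
  refine ⟨fun j => 1 - S j ^ 2, fun j m hm => ?_, fun q hq => ?_, ?_⟩
  · rw [coeff_one_sub (hSS0 j), Finsupp.support_neg, Finsupp.support_erase,
      Finset.mem_erase] at hm
    exact hSM j m hm.2 hm.1
  · have hq0 : 0 < q := two_pos.trans hq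
    have hbound : Tendsto (fun j : ℕ => rexp (4 * (4 ^ j * (j / 2 ^ j) ^ q)) - 1) atTop (𝓝 0) := by
      have hexp := (Real.continuous_exp.tendsto _).comp ((tendsto_four_pow_mul_rpow hq).const_mul 4)
      simpa using hexp.sub_const 1
    refine squeeze_zero (fun _ => qsum_nonneg _) (fun j => ?_) hbound
    rw [qsum_one_sub hq0.ne' (hSS0 j), hSq j q hq0.ne']
    exact sub_le_sub_right (qsum_rieszFactor_sq_pow_le hq0 j) 1
  · filter_upwards [ae_tendsto_trigPoly_zero hS hSsum] with x hx
    simpa using (hx.pow 2).const_sub 1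

end TrigPolyLimit

section UnitSeparated

/-- Uniform discreteness of a set of reals. The gap is fixed to be one so that it is preserved when
blocks at distance at least one are joined. -/
def UnitSeparated (S : Set ℝ) : Prop := S.Pairwise fun s t => 1 ≤ |s - t|

lemma unitSeparated_range_add_intCast (s : ℝ) : UnitSeparated (Set.range fun n : ℤ => s + n) := by
  rintro _ ⟨m, rfl⟩ _ ⟨n, rfl⟩ hmn
  have hne : m - n ≠ 0 := fun h => hmn (by rw [sub_eq_zero.1 h])
  rw [add_sub_add_left_eq_sub]
  exact_mod_cast Int.one_le_abs hne

lemma one_le_abs_sub_of_abs_add_one_le {s t : ℝ} (h : |s| + 1 ≤ |t|) : 1 ≤ |s - t| := by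
  rw [abs_sub_comm]
  linarith [abs_sub_abs_le_abs_sub t s]

lemma UnitSeparated.union {S T : Set ℝ} (hS : UnitSeparated S) (hT : UnitSeparated T)
    (hST : ∀ s ∈ S, ∀ t ∈ T, |s| + 1 ≤ |t|) : UnitSeparated (S ∪ T) :=
  Set.pairwise_union.2 ⟨hS, hT, fun s hs t ht _ =>
    have hst := one_le_abs_sub_of_abs_add_one_le (hST s hs t ht)
    ⟨hst, by rwa [abs_sub_comm]⟩⟩

lemma UnitSeparated.iUnion {S : ℕ → Set ℝ} (hS : ∀ j, UnitSeparated (S j)) {R : ℕ → ℝ}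
    (hR : Monotone R) (hle : ∀ j, ∀ s ∈ S j, R j ≤ |s|)
    (hlt : ∀ j, ∀ s ∈ S j, |s| + 1 ≤ R (j + 1)) :
    UnitSeparated (⋃ j, S j) := by
  have hfar {i j : ℕ} (hij : i < j) {s t : ℝ} (hs : s ∈ S i) (ht : t ∈ S j) : 1 ≤ |s - t| :=
    one_le_abs_sub_of_abs_add_one_le ((hlt i s hs).trans ((hR hij).trans (hle j t ht)))
  intro s hs t ht hst
  obtain ⟨i, hs⟩ := Set.mem_iUnion.1 hs
  obtain ⟨j, ht⟩ := Set.mem_iUnion.1 ht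
  rcases lt_trichotomy i j with hij | rfl | hij
  · exact hfar hij hs ht
  · exact hS i hs ht hst
  · rw [abs_sub_comm]
    exact hfar hij ht hs

lemma exists_forall_abs_le (s : Finset ℝ) : ∃ B : ℝ, ∀ x ∈ s, |x| ≤ B :=
  ⟨∑ x ∈ s, |x|, fun _ hx => Finset.single_le_sum (f := fun x => |x|) (fun _ _ => abs_nonneg _) hx⟩

lemma exists_unitSeparated_iUnion {F : ℕ → ℝ → Finset ℝ}
    (hsep : ∀ j r, UnitSeparated (F j r : Set ℝ)) (hfar : ∀ j r, ∀ s ∈ F j r, r ≤ |s|) :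
    ∃ R : ℕ → ℝ, UnitSeparated (⋃ j, (F j (R j) : Set ℝ)) := by
  choose B hB using fun j r => exists_forall_abs_le (F j r)
  let R : ℕ → ℝ := fun j => Nat.rec 0 (fun j r => max r (B j r + 1)) j
  have hR (j : ℕ) : R (j + 1) = max (R j) (B j (R j) + 1) := rfl
  refine ⟨R, .iUnion (fun j => hsep j _) (monotone_nat_of_le_succ fun j => ?_)
    (fun j => hfar j _) fun j s hs => ?_⟩
  · exact (le_max_left _ _).trans_eq (hR j).symm
  · rw [hR]
    exact (add_le_add_left (hB j _ s hs) 1).trans (le_max_right _ _)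

lemma UnitSeparated.countable {S : Set ℝ} (hS : UnitSeparated S) : S.Countable := by
  refine (Set.mapsTo_univ (Int.floor : ℝ → ℤ) S).countable_of_injOn (fun s hs t ht hst => ?_)
    Set.countable_univ
  by_contra hne
  exact (hS hs ht hne).not_gt (Int.abs_sub_lt_one_of_floor_eq_floor hst)

lemma UnitSeparated.exists_infinite_superset {S : Set ℝ} (hS : UnitSeparated S) :
    ∃ T, S ⊆ T ∧ T.Infinite ∧ UnitSeparated T := by
  rcases S.finite_or_infinite with hfin | hinf
  · obtain ⟨B, hB⟩ := exists_forall_abs_le hfin.toFinset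
    have hinj : Function.Injective fun n : ℕ => |B| + 1 + n := fun m n hmn => by simpa using hmn
    refine ⟨S ∪ Set.range fun n : ℕ => |B| + 1 + n, Set.subset_union_left,
      (Set.infinite_range_of_injective hinj).mono Set.subset_union_right, hS.union ?_ ?_⟩
    · refine (unitSeparated_range_add_intCast (|B| + 1)).mono ?_
      rintro _ ⟨n, rfl⟩
      exact ⟨n, by simp only [Int.cast_natCast]⟩
    · rintro s hs _ ⟨n, rfl⟩
      refine le_trans ?_ (le_abs_self _)
      linarith [hB s (hfin.mem_toFinset.2 hs), le_abs_self B, n.cast_nonneg (α := ℝ)]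
  · exact ⟨S, subset_rfl, hinf, hS⟩

lemma UnitSeparated.exists_isUniformlyDiscrete {S : Set ℝ} (hS : UnitSeparated S) :
    ∃ Λ : ℕ → ℝ, IsUniformlyDiscrete Λ ∧ S ⊆ Set.range Λ := by
  obtain ⟨T, hST, hinf, hT⟩ := hS.exists_infinite_superset
  have := hT.countable.to_subtype
  have := hinf.to_subtype
  obtain ⟨e⟩ : Nonempty (ℕ ≃ T) := nonempty_equiv_of_countable
  refine ⟨fun n => e n, ⟨1, one_pos, fun m n hmn => ?_⟩, fun s hs => ?_⟩
  · exact hT (e m).2 (e n).2 (Subtype.val_injective.ne (e.injective.ne hmn))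
  · exact ⟨e.symm ⟨s, hST hs⟩, congrArg Subtype.val (e.apply_symm_apply ⟨s, hST hs⟩)⟩

lemma IsUniformlyDiscrete.injective {ι : Type*} {Λ : ι → ℝ} (hΛ : IsUniformlyDiscrete Λ) :
    Λ.Injective := by
  obtain ⟨δ, hδ, hsep⟩ := hΛ
  intro m n hmn
  by_contra hne
  have := hsep m n hne
  rw [hmn, sub_self, abs_zero] at this
  linarith

end UnitSeparated

section FarApprox

open Finsupp (linearCombination)
open TopologicalSpace (SeparableSpace denseSeq denseRange_denseSeq)

variable {E : Type*} [NormedAddCommGroup E] [NormedSpace ℂ E] {u : ℝ → E} {q : ℝ} {f g : E}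

/-- `f` is approximated by combinations of vectors `u s` whose parameters `s` are separated and
arbitrarily large and whose coefficients are arbitrarily small in `ℓ_q`. As all these combinations
use parameters near infinity, countably many of them can be fitted into one separated set. -/
def FarApprox (u : ℝ → E) (q : ℝ) (f : E) : Prop :=
  ∀ ε > 0, ∀ R : ℝ, ∃ c : ℝ →₀ ℂ, UnitSeparated (c.support : Set ℝ) ∧
    (∀ s ∈ c.support, R ≤ |s|) ∧ ‖f - linearCombination ℂ u c‖ < ε ∧ qsum q c < ε

lemma FarApprox.zero : FarApprox u q 0 := fun ε hε _ =>
  ⟨0, by simp [UnitSeparated], by simp, by simpa using hε, by simpa [qsum] using hε⟩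

lemma FarApprox.add (hf : FarApprox u q f) (hg : FarApprox u q g) : FarApprox u q (f + g) := by
  intro ε hε R
  obtain ⟨c, hcsep, hcfar, hcf, hcq⟩ := hf (ε / 2) (half_pos hε) R
  obtain ⟨B, hB⟩ := exists_forall_abs_le c.support
  obtain ⟨d, hdsep, hdfar, hdg, hdq⟩ := hg (ε / 2) (half_pos hε) (max R (B + 1))
  have hcd : ∀ s ∈ c.support, ∀ t ∈ d.support, |s| + 1 ≤ |t| := fun s hs t ht => by
    linarith [hB s hs, (le_max_right _ _).trans (hdfar t ht)]
  have hdisj : Disjoint c.support d.support := Finset.disjoint_left.2 fun s hs hs' => by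
    linarith [hcd s hs s hs']
  have hsupp : (c + d).support = c.support ∪ d.support := Finsupp.support_add_eq hdisj
  refine ⟨c + d, ?_, ?_, ?_, ?_⟩
  · rw [hsupp, Finset.coe_union]
    exact hcsep.union hdsep hcd
  · rw [hsupp]
    intro s hs
    rcases Finset.mem_union.1 hs with hs | hs
    · exact hcfar s hs
    · exact (le_max_left _ _).trans (hdfar s hs)
  · rw [map_add, add_sub_add_comm]
    exact (norm_add_le _ _).trans_lt (by linarith)
  · rw [qsum_add_of_disjoint hdisj]
    linarith

lemma FarApprox.smul (hq : q ≠ 0) (b : ℂ) (hf : FarApprox u q f) : FarApprox u q (b • f) := by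
  intro ε hε R
  set K := 1 + ‖b‖ + ‖b‖ ^ q
  have hbq : 0 ≤ ‖b‖ ^ q := by positivity
  have hK : 0 < K := by positivity
  obtain ⟨c, hsep, hfar, hcf, hcq⟩ := hf (ε / K) (div_pos hε hK) R
  rw [lt_div_iff₀ hK] at hcf hcq
  refine ⟨b • c, hsep.mono (Finset.coe_subset.2 Finsupp.support_smul),
    fun s hs => hfar s (Finsupp.support_smul hs), ?_, ?_⟩
  · rw [map_smul, ← smul_sub, norm_smul]
    nlinarith [norm_nonneg b, norm_nonneg (f - linearCombination ℂ u c)]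
  · rw [qsum_smul hq]
    nlinarith [norm_nonneg b, qsum_nonneg (q := q) c]

lemma isClosed_setOf_farApprox : IsClosed {f | FarApprox u q f} := by
  refine isClosed_of_closure_subset fun f hf ε hε R => ?_
  obtain ⟨g, hg, hfg⟩ := Metric.mem_closure_iff.1 hf (ε / 2) (half_pos hε)
  obtain ⟨c, hsep, hfar, hcg, hcq⟩ := hg (ε / 2) (half_pos hε) R
  refine ⟨c, hsep, hfar, ?_, by linarith⟩
  rw [dist_eq_norm] at hfg
  linarith [norm_sub_le_norm_sub_add_norm_sub f g (linearCombination ℂ u c)]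

theorem FarApprox.of_span_topologicalClosure_eq_top (hq : q ≠ 0) (hu : ∀ s, FarApprox u q (u s))
    (hspan : (Submodule.span ℂ (Set.range u)).topologicalClosure = ⊤) (f : E) :
    FarApprox u q f := by
  let farApprox : Submodule ℂ E :=
    { carrier := {f | FarApprox u q f}
      zero_mem' := FarApprox.zero
      add_mem' := FarApprox.add
      smul_mem' := fun b _ => FarApprox.smul hq b }
  have hle : (Submodule.span ℂ (Set.range u)).topologicalClosure ≤ farApprox :=
    Submodule.topologicalClosure_minimal _
      (Submodule.span_le.2 (Set.range_subset_iff.2 hu)) isClosed_setOf_farApprox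
  exact hle (hspan ▸ Submodule.mem_top)

lemma exists_unitSeparated_forall_exists_approx [SeparableSpace E] {p : ℝ} (hp : 0 ≤ p)
    (hfar : ∀ q, p < q → ∀ f : E, FarApprox u q f) :
    ∃ S : Set ℝ, UnitSeparated S ∧ ∀ q, p < q → ∀ f : E, ∀ ε > 0,
      ∃ c : ℝ →₀ ℂ, ↑c.support ⊆ S ∧ ‖f - linearCombination ℂ u c‖ < ε ∧ qsum q c < ε := by
  have hpos (j : ℕ) : (0 : ℝ) < 1 / (j + 1) := Nat.one_div_pos_of_nat
  choose c hsep hlarge happrox hqsum using fun j : ℕ =>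
    hfar (p + 1 / (j + 1)) (lt_add_of_pos_right p (hpos j)) (denseSeq E j.unpair.1) _ (hpos j)
  obtain ⟨R, hR⟩ := exists_unitSeparated_iUnion hsep hlarge
  refine ⟨_, hR, fun q hq f ε hε => ?_⟩
  obtain ⟨k, hk⟩ : ∃ k, ‖f - denseSeq E k‖ < ε / 2 := by
    simpa only [dist_eq_norm] using (denseRange_denseSeq E).exists_dist_lt f (half_pos hε)
  have hlim : Tendsto (fun l => 1 / ((Nat.pair k l : ℝ) + 1)) atTop (𝓝 0) :=
    tendsto_one_div_add_atTop_nhds_zero_nat.comp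
      (tendsto_atTop_mono (fun l => Nat.right_le_pair k l) tendsto_id)
  obtain ⟨l, hlε, hlq, hl1⟩ := ((hlim.eventually_lt_const (half_pos hε)).and
    ((hlim.eventually_lt_const (sub_pos.2 hq)).and (hlim.eventually_lt_const one_pos))).exists
  set j := Nat.pair k l with hj
  have hjk := happrox j (R j)
  rw [hj, Nat.unpair_pair, ← hj] at hjk
  refine ⟨c j (R j), Set.subset_iUnion_of_subset j subset_rfl, ?_, ?_⟩
  · exact (norm_sub_le_norm_sub_add_norm_sub _ (denseSeq E k) _).trans_lt (by linarith)
  · have hanti : qsum q (c j (R j)) ≤ qsum (p + 1 / (j + 1)) (c j (R j)) :=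
      qsum_anti (add_pos_of_nonneg_of_pos hp (hpos j)) (by linarith) (by linarith [hqsum j (R j)])
    linarith [hqsum j (R j)]

variable {H : Type*} [NormedAddCommGroup H] [InnerProductSpace ℂ H]

lemma IsCompleteWithEstimate.of_forall_exists_small {ι : Type*} {u : ι → H} (hq : 0 < q)
    (h : ∀ f : H, ∀ ε > 0, ∃ c : ι →₀ ℂ, ‖f - linearCombination ℂ u c‖ < ε ∧ qsum q c < ε) :
    IsCompleteWithEstimate u q := by
  refine ⟨1, fun f ε hε => ?_⟩
  rcases eq_or_ne f 0 with rfl | hf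
  · exact ⟨0, by simpa using hε, by simp [hq.ne']⟩
  · obtain ⟨c, hcf, hcq⟩ := h f (min ε (‖f‖ ^ q)) (lt_min hε (by positivity))
    refine ⟨c, hcf.trans_le (min_le_left _ _), ?_⟩
    rw [one_mul, one_div]
    exact (Real.rpow_inv_le_iff_of_pos (qsum_nonneg c) (norm_nonneg f) hq).2
      (hcq.trans_le (min_le_right _ _)).le

theorem exists_isUniformlyDiscrete_isCompleteWithEstimate [SeparableSpace H] {u : ℝ → H} {p : ℝ}
    (hp : 0 ≤ p) (hfar : ∀ q, p < q → ∀ f : H, FarApprox u q f) :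
    ∃ Λ : ℕ → ℝ, IsUniformlyDiscrete Λ ∧ ∀ q, p < q → IsCompleteWithEstimate (u ∘ Λ) q := by
  obtain ⟨S, hS, happrox⟩ := exists_unitSeparated_forall_exists_approx hp hfar
  obtain ⟨Λ, hΛ, hSΛ⟩ := hS.exists_isUniformlyDiscrete
  refine ⟨Λ, hΛ, fun q hq => .of_forall_exists_small (hp.trans_lt hq) fun f ε hε => ?_⟩
  obtain ⟨c, hcS, hcf, hcq⟩ := happrox q hq f ε hε
  have hmap := Finsupp.mapDomain_comapDomain Λ hΛ.injective c (hcS.trans hSΛ)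
  refine ⟨c.comapDomain Λ hΛ.injective.injOn, ?_, ?_⟩
  · rwa [← Finsupp.linearCombination_mapDomain, hmap]
  · rwa [← qsum_mapDomain hΛ.injective, hmap]

end FarApprox

section Bessel

section GramMatrix

variable {𝕜 H ι : Type*} [RCLike 𝕜] [NormedAddCommGroup H] [InnerProductSpace 𝕜 H] {x : ι → H}
  {K : ℝ} {s : Finset ι}

lemma norm_sum_smul_sq_le_of_gram (hK : ∀ n ∈ s, ∑ m ∈ s, ‖inner 𝕜 (x n) (x m)‖ ≤ K)
    (a : ι → 𝕜) : ‖∑ n ∈ s, a n • x n‖ ^ 2 ≤ K * ∑ n ∈ s, ‖a n‖ ^ 2 := by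
  have hexpand : ‖∑ n ∈ s, a n • x n‖ ^ 2 ≤
      ∑ n ∈ s, ∑ m ∈ s, ‖a n‖ * ‖a m‖ * ‖inner 𝕜 (x n) (x m)‖ := by
    rw [← inner_self_eq_norm_sq (𝕜 := 𝕜), sum_inner]
    refine (RCLike.re_le_norm _).trans ((norm_sum_le _ _).trans (Finset.sum_le_sum fun n _ => ?_))
    rw [inner_sum]
    refine (norm_sum_le _ _).trans_eq (Finset.sum_congr rfl fun m _ => ?_)
    rw [inner_smul_left, inner_smul_right, norm_mul, norm_mul, RCLike.norm_conj, mul_assoc]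
  have hsymm : ∑ n ∈ s, ∑ m ∈ s, ‖a m‖ ^ 2 * ‖inner 𝕜 (x n) (x m)‖ =
      ∑ n ∈ s, ∑ m ∈ s, ‖a n‖ ^ 2 * ‖inner 𝕜 (x n) (x m)‖ := by
    rw [Finset.sum_comm]
    simp only [norm_inner_symm]
  have hamgm : 2 * ∑ n ∈ s, ∑ m ∈ s, ‖a n‖ * ‖a m‖ * ‖inner 𝕜 (x n) (x m)‖ ≤
      2 * ∑ n ∈ s, ∑ m ∈ s, ‖a n‖ ^ 2 * ‖inner 𝕜 (x n) (x m)‖ := by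
    rw [two_mul (∑ n ∈ s, ∑ m ∈ s, ‖a n‖ ^ 2 * _), ← hsymm]
    nth_rw 2 [hsymm]
    simp only [Finset.mul_sum, ← Finset.sum_add_distrib, ← add_mul, ← mul_assoc]
    gcongr with n _ m _
    linarith [two_mul_le_add_sq ‖a n‖ ‖a m‖]
  have hschur : ∑ n ∈ s, ∑ m ∈ s, ‖a n‖ ^ 2 * ‖inner 𝕜 (x n) (x m)‖ ≤
      K * ∑ n ∈ s, ‖a n‖ ^ 2 := by
    simp only [← Finset.mul_sum]
    rw [mul_comm, Finset.sum_mul]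
    exact Finset.sum_le_sum fun n hn => mul_le_mul_of_nonneg_left (hK n hn) (sq_nonneg _)
  linarith

lemma sum_norm_inner_sq_le_of_gram (hK : 0 ≤ K)
    (hgram : ∀ n ∈ s, ∑ m ∈ s, ‖inner 𝕜 (x n) (x m)‖ ≤ K) (v : H) :
    ∑ n ∈ s, ‖inner 𝕜 (x n) v‖ ^ 2 ≤ K * ‖v‖ ^ 2 := by
  set T := ∑ n ∈ s, ‖inner 𝕜 (x n) v‖ ^ 2
  set w := ∑ n ∈ s, inner 𝕜 (x n) v • x n
  have hwv : inner 𝕜 w v = (T : 𝕜) := by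
    simp only [w, T, sum_inner, inner_smul_left, RCLike.conj_mul, map_sum, map_pow]
  have hT : 0 ≤ T := Finset.sum_nonneg fun _ _ => sq_nonneg _
  have hTw : T ≤ ‖w‖ * ‖v‖ := by
    simpa only [hwv, RCLike.norm_ofReal, abs_of_nonneg hT] using norm_inner_le_norm (𝕜 := 𝕜) w v
  have hw : ‖w‖ ^ 2 ≤ K * T := norm_sum_smul_sq_le_of_gram hgram _
  have hTT : T * T ≤ T * (K * ‖v‖ ^ 2) := by
    calc T * T ≤ (‖w‖ * ‖v‖) ^ 2 := by nlinarith
      _ = ‖w‖ ^ 2 * ‖v‖ ^ 2 := mul_pow _ _ _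
      _ ≤ K * T * ‖v‖ ^ 2 := by gcongr
      _ = T * (K * ‖v‖ ^ 2) := by ring
  rcases hT.eq_or_lt with hT0 | hT0
  · rw [← hT0]
    positivity
  · exact le_of_mul_le_mul_left hTT hT0

end GramMatrix

section IsBessel

variable {H H' ι : Type*} [NormedAddCommGroup H] [InnerProductSpace ℂ H] [NormedAddCommGroup H']
  [InnerProductSpace ℂ H'] {u : ι → H}

lemma IsBessel.of_sum_le {K : ℝ} (hK : 0 ≤ K)
    (h : ∀ (f : H) (s : Finset ι), ∑ n ∈ s, ‖inner ℂ (u n) f‖ ^ 2 ≤ K * ‖f‖ ^ 2) : IsBessel u := by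
  refine ⟨√K, fun f => ?_⟩
  have hsum := summable_of_sum_le (fun n => sq_nonneg _) (h f)
  refine ⟨hsum, ?_⟩
  rw [Real.sqrt_le_left (by positivity), mul_pow, Real.sq_sqrt hK]
  exact hsum.tsum_le_of_sum_le (h f)

lemma IsBessel.map [CompleteSpace H] [CompleteSpace H'] (hu : IsBessel u) (T : H →L[ℂ] H') :
    IsBessel (T ∘ u) := by
  obtain ⟨C, hC⟩ := hu
  refine ⟨|C| * ‖T.adjoint‖, fun f => ?_⟩
  simp only [Function.comp_apply, ← ContinuousLinearMap.adjoint_inner_right]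
  refine ⟨(hC _).1, (hC _).2.trans ?_⟩
  calc C * ‖T.adjoint f‖ ≤ |C| * (‖T.adjoint‖ * ‖f‖) := by
        gcongr
        · exact le_abs_self C
        · exact T.adjoint.le_opNorm f
    _ = |C| * ‖T.adjoint‖ * ‖f‖ := (mul_assoc _ _ _).symm

lemma IsCompleteWithEstimate.map {q : ℝ} (hu : IsCompleteWithEstimate u q) (U : H ≃ₗᵢ[ℂ] H') :
    IsCompleteWithEstimate (U ∘ u) q := by
  obtain ⟨C, hC⟩ := hu
  refine ⟨C, fun f ε hε => ?_⟩
  obtain ⟨c, hcf, hcq⟩ := hC (U.symm f) ε hε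
  refine ⟨c, ?_, by rwa [U.symm.norm_map] at hcq⟩
  rw [← U.norm_map, map_sub, U.apply_symm_apply, map_finsuppSum] at hcf
  simpa only [map_smul, Function.comp_apply] using hcf

lemma IsQuasiFrame.map [CompleteSpace H] [CompleteSpace H'] (hu : IsQuasiFrame u)
    (U : H ≃ₗᵢ[ℂ] H') : IsQuasiFrame (U ∘ u) := by
  refine ⟨fun q hq => (hu.1 q hq).map U, ?_⟩
  exact hu.2.map (U.toContinuousLinearEquiv : H →L[ℂ] H')

end IsBessel

section GaussianSum

variable {b : ℝ}

lemma summable_exp_neg_mul_intCast_sq (hb : 0 < b) :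
    Summable fun k : ℤ => rexp (-b * (k : ℝ) ^ 2) := by
  have hnat : Summable fun k : ℕ => rexp (-b * (k : ℝ) ^ 2) :=
    Real.summable_exp_nat_mul_of_ge (neg_lt_zero.2 hb) fun k => by
      exact_mod_cast Nat.le_self_pow two_ne_zero k
  exact .of_nat_of_neg (by simpa using hnat) (by simpa using hnat)

lemma exp_neg_mul_sq_le_floor (hb : 0 ≤ b) (z : ℝ) :
    rexp (-b * z ^ 2) ≤ rexp b * rexp (-(b / 2) * (⌊z⌋ : ℝ) ^ 2) := by
  have hsq : (⌊z⌋ : ℝ) ^ 2 ≤ 2 * z ^ 2 + 2 := by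
    nlinarith [Int.floor_le z, Int.lt_floor_add_one z, sq_nonneg (2 * z - ⌊z⌋)]
  rw [← Real.exp_add, Real.exp_le_exp]
  nlinarith

lemma IsUniformlyDiscrete.exists_sum_exp_neg_mul_sq_le {ι : Type*} {Λ : ι → ℝ}
    (hΛ : IsUniformlyDiscrete Λ) (hb : 0 < b) :
    ∃ K, 0 ≤ K ∧ ∀ (s : Finset ι) (t : ℝ), ∑ n ∈ s, rexp (-b * (Λ n - t) ^ 2) ≤ K := by
  obtain ⟨δ, hδ, hsep⟩ := hΛ
  have hbδ : 0 < b * δ ^ 2 := by positivity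
  set G : ℤ → ℝ := fun k => rexp (-(b * δ ^ 2 / 2) * (k : ℝ) ^ 2)
  have hG : Summable G := summable_exp_neg_mul_intCast_sq (half_pos hbδ)
  have hG0 (k : ℤ) : 0 ≤ G k := (Real.exp_pos _).le
  refine ⟨rexp (b * δ ^ 2) * ∑' k, G k, mul_nonneg (Real.exp_pos _).le (tsum_nonneg hG0),
    fun s t => ?_⟩
  let φ : ι → ℤ := fun n => ⌊(Λ n - t) / δ⌋
  have hφ : Function.Injective φ := fun m n hmn => by
    by_contra hne
    have hlt := Int.abs_sub_lt_one_of_floor_eq_floor hmn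
    rw [← sub_div, sub_sub_sub_cancel_right, abs_div, abs_of_pos hδ, div_lt_one hδ] at hlt
    exact (hsep m n hne).not_gt hlt
  have hterm (n : ι) : rexp (-b * (Λ n - t) ^ 2) ≤ rexp (b * δ ^ 2) * G (φ n) := by
    have hle := exp_neg_mul_sq_le_floor hbδ.le ((Λ n - t) / δ)
    rwa [div_pow, ← neg_mul, mul_assoc (-b), mul_div_cancel₀ _ (pow_ne_zero 2 hδ.ne')] at hle
  calc ∑ n ∈ s, rexp (-b * (Λ n - t) ^ 2)
      ≤ ∑ n ∈ s, rexp (b * δ ^ 2) * G (φ n) := Finset.sum_le_sum fun n _ => hterm n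
    _ = rexp (b * δ ^ 2) * ∑ k ∈ s.map ⟨φ, hφ⟩, G k := by
        rw [Finset.sum_map, Finset.mul_sum, Function.Embedding.coeFn_mk]
    _ ≤ rexp (b * δ ^ 2) * ∑' k, G k := by
        gcongr
        exact hG.sum_le_tsum _ fun k _ => hG0 k

end GaussianSum

end Bessel

section DominatedConvergence

variable {α E F : Type*} [MeasurableSpace α] {μ : Measure α} [NormedAddCommGroup E]
  [NormedAddCommGroup F] {p : ℝ≥0∞}

lemma tendsto_Lp_zero_of_dominated [Fact (1 ≤ p)] (hp : p ≠ ∞) {f : ℕ → Lp E p μ} {g : Lp F p μ}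
    (hle : ∀ n, ∀ᵐ x ∂μ, ‖f n x‖ ≤ ‖g x‖)
    (hlim : ∀ᵐ x ∂μ, Tendsto (fun n => f n x) atTop (𝓝 0)) :
    Tendsto f atTop (𝓝 0) := by
  have hp0 : p ≠ 0 := (one_pos.trans_le Fact.out).ne'
  have hpos : 0 < p.toReal := ENNReal.toReal_pos hp0 hp
  have hint : Tendsto (fun n => ∫⁻ x, ‖f n x‖ₑ ^ p.toReal ∂μ) atTop (𝓝 (∫⁻ _, 0 ∂μ)) := by
    refine tendsto_lintegral_of_dominated_convergence' (fun x => ‖g x‖ₑ ^ p.toReal)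
      (fun n => (Lp.aestronglyMeasurable (f n)).enorm.pow_const _) (fun n => ?_)
      (lintegral_rpow_enorm_lt_top_of_eLpNorm_lt_top hp0 hp (Lp.eLpNorm_lt_top g)).ne ?_
    · filter_upwards [hle n] with x hx
      exact ENNReal.rpow_le_rpow (enorm_le_iff_norm_le.2 hx) hpos.le
    · filter_upwards [hlim] with x hx
      simpa only [enorm_zero, ENNReal.zero_rpow_of_pos hpos]
        using hx.enorm.ennrpow_const p.toReal
  rw [tendsto_iff_edist_tendsto_0]
  rw [lintegral_zero] at hint
  have hroot := hint.ennrpow_const (1 / p.toReal)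
  rw [ENNReal.zero_rpow_of_pos (one_div_pos.2 hpos)] at hroot
  refine hroot.congr fun n => ?_
  rw [edist_zero_right, Lp.enorm_def, eLpNorm_eq_lintegral_rpow_enorm_toReal hp0 hp]

lemma exists_measurable_forall_mul_le_one {f : ℕ → α → ℝ} (hf : ∀ j, Measurable (f j))
    (hbdd : ∀ᵐ x ∂μ, BddAbove (Set.range fun j => f j x)) :
    ∃ w : α → ℝ, Measurable w ∧ (∀ x, 0 < w x ∧ w x ≤ 1) ∧ ∀ᵐ x ∂μ, ∀ j, f j x * w x ≤ 1 := by
  have hpos (x : α) : 0 < 1 + |⨆ j, f j x| := by positivity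
  refine ⟨fun x => (1 + |⨆ j, f j x|)⁻¹, ?_, fun x => ⟨inv_pos.2 (hpos x), ?_⟩, ?_⟩
  · exact (measurable_const.add (Measurable.iSup hf).abs).inv
  · exact inv_le_one_of_one_le₀ (le_add_of_nonneg_right (abs_nonneg _))
  · filter_upwards [hbdd] with x hx j
    rw [← div_eq_mul_inv, div_le_one (hpos x)]
    exact (le_ciSup hx j).trans ((le_abs_self _).trans (le_add_of_nonneg_left zero_le_one))

end DominatedConvergence

section Multiplication

variable {α 𝕜 : Type*} [MeasurableSpace α] {μ : Measure α} [RCLike 𝕜] {φ ψ : α → 𝕜}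

/-- Multiplication by an essentially bounded function, as an operator on `L²`. It serves for the
characters, for the damping weight, and for Gaussians. -/
def mulL2 (hφ : MemLp φ ∞ μ) : Lp 𝕜 2 μ →L[𝕜] Lp 𝕜 2 μ :=
  (ContinuousLinearMap.mul 𝕜 𝕜).holderL μ ∞ 2 2 (hφ.toLp φ)

lemma coeFn_mulL2 (hφ : MemLp φ ∞ μ) (f : Lp 𝕜 2 μ) : mulL2 hφ f =ᵐ[μ] fun x => φ x * f x := by
  filter_upwards [(ContinuousLinearMap.mul 𝕜 𝕜).coeFn_holder (r := 2) (hφ.toLp φ) f,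
    hφ.coeFn_toLp] with x hx hφx
  exact hx.trans (by rw [hφx, ContinuousLinearMap.mul_apply'])

lemma mulL2_mulL2_comm (hφ : MemLp φ ∞ μ) (hψ : MemLp ψ ∞ μ) (f : Lp 𝕜 2 μ) :
    mulL2 hφ (mulL2 hψ f) = mulL2 hψ (mulL2 hφ f) := by
  refine Lp.ext ?_
  filter_upwards [coeFn_mulL2 hφ (mulL2 hψ f), coeFn_mulL2 hψ f, coeFn_mulL2 hψ (mulL2 hφ f),
    coeFn_mulL2 hφ f] with x h₁ h₂ h₃ h₄
  rw [h₁, h₂, h₃, h₄, mul_left_comm]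

lemma inner_mulL2_left (hφ : MemLp φ ∞ μ) (f g : Lp 𝕜 2 μ) :
    inner 𝕜 (mulL2 hφ f) g = inner 𝕜 f (mulL2 hφ.star g) := by
  rw [L2.inner_def, L2.inner_def]
  refine integral_congr_ae ?_
  filter_upwards [coeFn_mulL2 hφ f, coeFn_mulL2 hφ.star g] with x hf hg
  rw [hf, hg, RCLike.inner_apply', RCLike.inner_apply', map_mul, Pi.star_apply]
  simp [mul_comm, mul_left_comm]

end Multiplication

section Modulation

lemma memLp_modChar (a : ℝ) : MemLp (modChar a) ∞ volume :=
  memLp_top_of_bound (continuous_modChar a).aestronglyMeasurable 1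
    (Eventually.of_forall fun x => (norm_modChar a x).le)

/-- The modulation `f ↦ exp (-2πi a ·) f` on `L²(ℝ)`, which is the translation by `a` on the
Fourier transform side. -/
def modL2 (a : ℝ) : Lp ℂ 2 (volume : Measure ℝ) →L[ℂ] Lp ℂ 2 (volume : Measure ℝ) :=
  mulL2 (memLp_modChar a)

lemma fourier_comp_sub_right (f : ℝ → ℂ) (a t : ℝ) :
    𝓕 (fun x => f (x - a)) t = modChar a t * 𝓕 f t := by
  have hshift := congrFun (VectorFourier.fourierIntegral_comp_add_right Real.fourierChar volume
    (innerₗ ℝ) f (-a)) t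
  refine hshift.trans ?_
  rw [innerₗ_apply_apply, RCLike.inner_apply', conj_trivial, neg_mul]
  rfl

variable (a b : ℝ) (f g : Lp ℂ 2 (volume : Measure ℝ))

lemma coeFn_modL2 : modL2 a f =ᵐ[volume] fun x => modChar a x * f x := coeFn_mulL2 _ f

lemma modL2_add : modL2 (a + b) f = modL2 a (modL2 b f) := by
  refine Lp.ext ?_
  filter_upwards [coeFn_modL2 (a + b) f, coeFn_modL2 a (modL2 b f), coeFn_modL2 b f]
    with x hab ha hb
  rw [hab, ha, hb, modChar_add, mul_assoc]

lemma norm_modL2 : ‖modL2 a f‖ = ‖f‖ := by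
  rw [Lp.norm_def, Lp.norm_def]
  refine congrArg _ (eLpNorm_congr_norm_ae ?_)
  filter_upwards [coeFn_modL2 a f] with x hx
  rw [hx, norm_mul, norm_modChar, one_mul]

lemma modL2_mulL2_comm {φ : ℝ → ℂ} (hφ : MemLp φ ∞ volume) :
    modL2 a (mulL2 hφ f) = mulL2 hφ (modL2 a f) :=
  mulL2_mulL2_comm _ hφ f

lemma inner_modL2_left : inner ℂ (modL2 a f) g = inner ℂ f (modL2 (-a) g) := by
  have hstar : star (modChar a) = modChar (-a) := funext (star_modChar a)
  simp only [modL2, inner_mulL2_left, hstar]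

lemma inner_modL2_left_eq_fourier :
    inner ℂ (modL2 a f) g = 𝓕 (fun x => conj (f x) * g x) (-a) := by
  rw [inner_modL2_left, L2.inner_def, Real.fourier_real_eq]
  refine integral_congr_ae ?_
  filter_upwards [coeFn_modL2 (-a) g] with x hx
  rw [hx, RCLike.inner_apply', Circle.smul_def, smul_eq_mul, mul_left_comm, modChar, mul_comm x]

lemma inner_modL2_modL2 : inner ℂ (modL2 a f) (modL2 b g) = inner ℂ (modL2 (a - b) f) g := by
  rw [inner_modL2_left, ← modL2_add, inner_modL2_left, neg_sub, neg_add_eq_sub]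

end Modulation

section Gaussian

/-- The Gaussian centred at `N`, normalized to have height one. It is complex-valued so as to be a
multiplier of the complex `L²(ℝ)`. -/
def gaussianAt (N x : ℝ) : ℂ := rexp (-π * (x - N) ^ 2)

lemma continuous_gaussianAt (N : ℝ) : Continuous (gaussianAt N) := by
  unfold gaussianAt
  fun_prop

lemma norm_gaussianAt (N x : ℝ) : ‖gaussianAt N x‖ = rexp (-π * (x - N) ^ 2) := by
  rw [gaussianAt, Complex.norm_real, Real.norm_of_nonneg (Real.exp_pos _).le]

lemma star_gaussianAt (N : ℝ) : star (gaussianAt N) = gaussianAt N :=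
  funext fun _ => Complex.conj_ofReal _

lemma norm_gaussianAt_le_one (N x : ℝ) : ‖gaussianAt N x‖ ≤ 1 := by
  rw [norm_gaussianAt, Real.exp_le_one_iff, neg_mul, neg_nonpos]
  positivity

lemma memLp_top_gaussianAt (N : ℝ) : MemLp (gaussianAt N) ∞ volume :=
  memLp_top_of_bound (continuous_gaussianAt N).aestronglyMeasurable 1
    (Eventually.of_forall (norm_gaussianAt_le_one N))

lemma memLp_two_gaussianAt (N : ℝ) : MemLp (gaussianAt N) 2 volume := by
  rw [memLp_two_iff_integrable_sq_norm (continuous_gaussianAt N).aestronglyMeasurable]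
  have hint := (integrable_exp_neg_mul_sq (b := 2 * π) (by positivity)).comp_sub_right N
  refine hint.congr (Eventually.of_forall fun x => ?_)
  simp only [norm_gaussianAt, ← Real.exp_nat_mul]
  push_cast
  ring_nf

/-- The Gaussian centred at `N`, as an element of `L²(ℝ)`: the window with explicit Gram matrix to
which all Bessel estimates are reduced. -/
def gaussL2 (N : ℝ) : Lp ℂ 2 (volume : Measure ℝ) := (memLp_two_gaussianAt N).toLp _

lemma coeFn_gaussL2 (N : ℝ) : gaussL2 N =ᵐ[volume] gaussianAt N :=
  (memLp_two_gaussianAt N).coeFn_toLp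

lemma norm_fourier_sq_gaussianAt_le (N t : ℝ) :
    ‖𝓕 (fun x => gaussianAt N x ^ 2) t‖ ≤ rexp (-(π / 2) * t ^ 2) := by
  have hsq : (fun x => gaussianAt N x ^ 2) =
      fun x => Complex.exp (-π * 2 * ((x - N : ℝ) : ℂ) ^ 2) := by
    ext x
    rw [gaussianAt, Complex.ofReal_exp, ← Complex.exp_nat_mul]
    push_cast
    ring_nf
  have hroot : ‖1 / (2 : ℂ) ^ (1 / 2 : ℂ)‖ ≤ 1 := by
    rw [norm_div, norm_one, ← Complex.ofReal_ofNat 2, Complex.norm_cpow_eq_rpow_re_of_pos two_pos]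
    exact div_le_one_of_le₀ (Real.one_le_rpow one_le_two (by norm_num)) (by positivity)
  have hexp : (-π / 2 * t ^ 2 : ℂ) = (-(π / 2) * t ^ 2 : ℝ) := by
    push_cast
    ring
  rw [hsq, fourier_comp_sub_right fun y : ℝ => Complex.exp (-π * 2 * y ^ 2), norm_mul,
    norm_modChar, one_mul, fourier_gaussian_pi (by simp), norm_mul, hexp, ← Complex.ofReal_exp,
    Complex.norm_of_nonneg (Real.exp_pos _).le]
  exact mul_le_of_le_one_left (Real.exp_pos _).le hroot

lemma norm_inner_modL2_gaussL2_le (a b N : ℝ) :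
    ‖inner ℂ (modL2 a (gaussL2 N)) (modL2 b (gaussL2 N))‖ ≤ rexp (-(π / 2) * (b - a) ^ 2) := by
  have hsq : (fun x => conj (gaussL2 N x) * gaussL2 N x) =ᵐ[volume]
      fun x => gaussianAt N x ^ 2 := by
    filter_upwards [coeFn_gaussL2 N] with x hx
    rw [hx, sq, gaussianAt, Complex.conj_ofReal]
  rw [inner_modL2_modL2, inner_modL2_left_eq_fourier, neg_sub, Real.fourier_congr_ae hsq]
  exact norm_fourier_sq_gaussianAt_le N (b - a)

theorem IsUniformlyDiscrete.exists_sum_norm_inner_gaussL2_le {ι : Type*} {Λ : ι → ℝ}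
    (hΛ : IsUniformlyDiscrete Λ) :
    ∃ K, 0 ≤ K ∧ ∀ (N : ℝ) (f : Lp ℂ 2 (volume : Measure ℝ)) (s : Finset ι),
      ∑ n ∈ s, ‖inner ℂ (modL2 (Λ n) (gaussL2 N)) f‖ ^ 2 ≤ K * ‖f‖ ^ 2 := by
  obtain ⟨K, hK, hsum⟩ := hΛ.exists_sum_exp_neg_mul_sq_le (half_pos pi_pos)
  refine ⟨K, hK, fun N f s => sum_norm_inner_sq_le_of_gram hK (fun n _ => ?_) f⟩
  exact (Finset.sum_le_sum fun m _ => norm_inner_modL2_gaussL2_le _ _ N).trans (hsum s (Λ n))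

end Gaussian

section FourierTranslation

lemma translateL2_toLp (a : ℝ) (f : 𝓢(ℝ, ℂ)) :
    translateL2 a (f.toLp 2) = (f.compSubConstCLM ℂ a).toLp 2 := by
  refine Lp.ext ?_
  have hcomp := (measurePreserving_sub_right volume a).quasiMeasurePreserving.ae_eq_comp
    (f.coeFn_toLp 2 volume)
  filter_upwards [Lp.coeFn_compMeasurePreserving (f.toLp 2 (μ := volume))
    (measurePreserving_sub_right volume a), hcomp, (f.compSubConstCLM ℂ a).coeFn_toLp 2 volume]
    with x hx hfx hax
  rw [hax]
  exact hx.trans hfx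

lemma fourier_translateL2_toLp (a : ℝ) (f : 𝓢(ℝ, ℂ)) :
    𝓕 (translateL2 a (f.toLp 2)) = modL2 a (𝓕 (f.toLp 2)) := by
  rw [translateL2_toLp, SchwartzMap.toLp_fourier_eq, SchwartzMap.toLp_fourier_eq]
  refine Lp.ext ?_
  filter_upwards [(𝓕 (f.compSubConstCLM ℂ a)).coeFn_toLp 2 volume,
    (𝓕 f).coeFn_toLp 2 volume, coeFn_modL2 a ((𝓕 f).toLp 2)] with x htrans hfour hmod
  rw [htrans, hmod, hfour, SchwartzMap.fourier_coe, SchwartzMap.fourier_coe]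
  exact fourier_comp_sub_right f a x

theorem fourier_translateL2 (a : ℝ) (g : Lp ℂ 2 (volume : Measure ℝ)) :
    𝓕 (translateL2 a g) = modL2 a (𝓕 g) := by
  refine DenseRange.induction_on (p := fun g => 𝓕 (translateL2 a g) = modL2 a (𝓕 g))
    (SchwartzMap.denseRange_toLpCLM (p := 2) ENNReal.ofNat_ne_top) g ?_ (fourier_translateL2_toLp a)
  exact isClosed_eq
    ((Lp.fourierTransformₗᵢ ℝ ℂ).continuous.comp (Lp.isometry_compMeasurePreserving _).continuous)
    ((modL2 a).continuous.comp (Lp.fourierTransformₗᵢ ℝ ℂ).continuous)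

lemma fourierInv_modL2 (a : ℝ) (h : Lp ℂ 2 (volume : Measure ℝ)) :
    𝓕⁻ (modL2 a h) = translateL2 a (𝓕⁻ h) := by
  refine (Lp.fourierTransformₗᵢ ℝ ℂ).symm_apply_eq.2 ?_
  exact ((fourier_translateL2 a _).trans
    (congrArg _ (FourierTransform.fourier_fourierInv_eq h))).symm

lemma inner_translateL2 (a : ℝ) (g f : Lp ℂ 2 (volume : Measure ℝ)) :
    inner ℂ (translateL2 a g) f = inner ℂ (modL2 a (𝓕 g)) (𝓕 f) := by
  rw [← fourier_translateL2, Lp.inner_fourier_eq]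

lemma isQuasiFrame_translateL2_fourierInv {ι : Type*} {Λ : ι → ℝ}
    {h : Lp ℂ 2 (volume : Measure ℝ)} (hu : IsQuasiFrame fun n => modL2 (Λ n) h) :
    IsQuasiFrame fun n => translateL2 (Λ n) (𝓕⁻ h) := by
  have hcomp : ((Lp.fourierTransformₗᵢ ℝ ℂ).symm ∘ fun n => modL2 (Λ n) h) =
      fun n => translateL2 (Λ n) (𝓕⁻ h) := funext fun n => fourierInv_modL2 (Λ n) h
  exact hcomp ▸ hu.map (Lp.fourierTransformₗᵢ ℝ ℂ).symm

end FourierTranslation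

section Density

variable {V E : Type*} [NormedAddCommGroup V] [InnerProductSpace ℝ V] [FiniteDimensional ℝ V]
  [MeasurableSpace V] [BorelSpace V] [NormedAddCommGroup E] [NormedSpace ℂ E] [CompleteSpace E]

/- An integrable function need not have an integrable Fourier transform, so Fourier inversion is
applied to the test functions instead. -/
lemma ae_eq_zero_of_fourier_eq_zero {f : V → E} (hf : Integrable f) (h : 𝓕 f = 0) :
    ∀ᵐ x, f x = 0 := by
  refine ae_eq_zero_of_integral_contDiff_smul_eq_zero hf.locallyIntegrable fun φ hφ hφc => ?_
  have hc : HasCompactSupport (Complex.ofRealCLM ∘ φ) := hφc.comp_left rfl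
  have hd : ContDiff ℝ ((⊤ : ℕ∞) : WithTop ℕ∞) (Complex.ofRealCLM ∘ φ) := by fun_prop
  let ψ : 𝓢(V, ℂ) := hc.toSchwartzMap hd
  have hψ : 𝓕 ⇑(𝓕⁻ ψ : 𝓢(V, ℂ)) = ψ := by
    rw [← SchwartzMap.fourier_coe, FourierTransform.fourier_fourierInv_eq]
  have hflip : ∫ x, 𝓕 ⇑(𝓕⁻ ψ : 𝓢(V, ℂ)) x • f x = ∫ ξ, (𝓕⁻ ψ : 𝓢(V, ℂ)) ξ • 𝓕 f ξ := by
    simpa using! VectorFourier.integral_fourierIntegral_smul_eq_flip (L := innerₗ V)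
      Real.continuous_fourierChar continuous_inner (𝓕⁻ ψ : 𝓢(V, ℂ)).integrable hf
  calc ∫ x, φ x • f x = ∫ x, ψ x • f x := rfl
    _ = 0 := by rw [← hψ, hflip, h]; simp only [Pi.zero_apply, smul_zero, integral_zero]

lemma span_modL2_topologicalClosure_eq_top {g : Lp ℂ 2 (volume : Measure ℝ)}
    (hg : ∀ᵐ x, g x ≠ 0) :
    (Submodule.span ℂ (Set.range fun a => modL2 a g)).topologicalClosure = ⊤ := by
  rw [Submodule.topologicalClosure_eq_top_iff, Submodule.eq_bot_iff]
  intro v hv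
  have hint : Integrable fun x => conj (g x) * v x := by
    simpa only [RCLike.inner_apply'] using L2.integrable_inner (𝕜 := ℂ) g v
  have hfourier : 𝓕 (fun x => conj (g x) * v x) = 0 := by
    ext a
    rw [← neg_neg a, ← inner_modL2_left_eq_fourier]
    exact (Submodule.mem_orthogonal _ v).1 hv _ (Submodule.subset_span ⟨-a, rfl⟩)
  rw [Lp.eq_zero_iff_ae_eq_zero]
  filter_upwards [ae_eq_zero_of_fourier_eq_zero hint hfourier, hg] with x hx hgx
  exact (mul_eq_zero.1 hx).resolve_left ((map_ne_zero _).2 hgx)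

end Density

section TrigPolyModulation

open Finsupp (linearCombination)

variable {g : Lp ℂ 2 (volume : Measure ℝ)}

lemma coeFn_linearCombination_modL2 (p : ℂ[T;T⁻¹]) (g : Lp ℂ 2 (volume : Measure ℝ)) :
    linearCombination ℂ (fun n : ℤ => modL2 n g) p.coeff =ᵐ[volume]
      fun x => trigPoly x p * g x := by
  induction p using LaurentPolynomial.induction_on' with
  | add p r hp hr =>
    rw [AddMonoidAlgebra.coeff_add, map_add]
    filter_upwards [Lp.coeFn_add (linearCombination ℂ (fun n : ℤ => modL2 n g) p.coeff)
      (linearCombination ℂ (fun n : ℤ => modL2 n g) r.coeff), hp, hr] with x hx hpx hrx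
    rw [hx, Pi.add_apply, hpx, hrx, map_add, add_mul]
  | C_mul_T n a =>
    rw [← LaurentPolynomial.single_eq_C_mul_T, AddMonoidAlgebra.coeff_single,
      Finsupp.linearCombination_single]
    filter_upwards [Lp.coeFn_smul a (modL2 n g), coeFn_modL2 n g] with x hx hmod
    rw [hx, Pi.smul_apply, hmod, LaurentPolynomial.single_eq_C_mul_T, trigPoly_C_mul_T,
      smul_eq_mul, mul_assoc]

lemma linearCombination_modL2_mapDomain_add (s : ℝ) (c : ℤ →₀ ℂ) :
    linearCombination ℂ (fun a => modL2 a g) (c.mapDomain fun n : ℤ => s + n) =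
      modL2 s (linearCombination ℂ (fun n : ℤ => modL2 n g) c) := by
  rw [Finsupp.linearCombination_mapDomain]
  simp only [Finsupp.linearCombination_apply, map_finsuppSum, map_smul, Function.comp_apply,
    modL2_add]

lemma farApprox_modL2 {p : ℕ → ℂ[T;T⁻¹]} {q : ℝ}
    (hfar : ∀ j, ∀ m ∈ (p j).coeff.support, (j : ℤ) ≤ |m|)
    (hq : Tendsto (fun j => qsum q (p j).coeff) atTop (𝓝 0))
    (hg : Tendsto (fun j => g - linearCombination ℂ (fun n : ℤ => modL2 n g) (p j).coeff)
      atTop (𝓝 0)) (s : ℝ) :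
    FarApprox (fun a => modL2 a g) q (modL2 s g) := by
  intro ε hε R
  obtain ⟨j, hqj, hgj, hj⟩ := ((hq.eventually_lt_const hε).and
    ((hg.norm.eventually_lt_const (by rwa [norm_zero])).and
      (eventually_ge_atTop ⌈R + |s|⌉₊))).exists
  have hinj : Function.Injective fun n : ℤ => s + n :=
    (add_right_injective s).comp Int.cast_injective
  have hsupp (x : ℝ) (hx : x ∈ ((p j).coeff.mapDomain fun n : ℤ => s + n).support) :
      ∃ m ∈ (p j).coeff.support, s + m = x :=
    Finset.mem_image.1 (Finsupp.mapDomain_support hx)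
  refine ⟨(p j).coeff.mapDomain fun n : ℤ => s + n, ?_, fun x hx => ?_, ?_, ?_⟩
  · exact (unitSeparated_range_add_intCast s).mono fun x hx =>
      (hsupp x hx).imp fun _ => And.right
  · obtain ⟨m, hm, rfl⟩ := hsupp x hx
    have hjm : (j : ℝ) ≤ |(m : ℝ)| := by exact_mod_cast hfar j m hm
    have hms : |(m : ℝ)| ≤ |s + m| + |s| := by simpa using abs_sub (s + m) s
    linarith [Nat.ceil_le.1 hj]
  · rwa [linearCombination_modL2_mapDomain_add, ← map_sub, norm_modL2]
  · rwa [qsum_mapDomain hinj]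

lemma tendsto_sub_linearCombination_modL2 {w : ℝ → ℂ} (hw : MemLp w ∞ volume)
    {p : ℕ → ℂ[T;T⁻¹]} (hlim : ∀ᵐ x : ℝ, Tendsto (fun j => trigPoly x (p j)) atTop (𝓝 1))
    (hle : ∀ᵐ x : ℝ, ∀ j, ‖1 - trigPoly x (p j)‖ * ‖w x‖ ≤ 1) :
    Tendsto (fun j => mulL2 hw g - linearCombination ℂ (fun n : ℤ => modL2 n (mulL2 hw g))
      (p j).coeff) atTop (𝓝 0) := by
  have hcoe : ∀ᵐ x, ∀ j, (mulL2 hw g - linearCombination ℂ (fun n : ℤ => modL2 n (mulL2 hw g))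
      (p j).coeff : Lp ℂ 2 volume) x = (1 - trigPoly x (p j)) * (w x * g x) := by
    refine ae_all_iff.2 fun j => ?_
    filter_upwards [Lp.coeFn_sub (mulL2 hw g) (linearCombination ℂ _ (p j).coeff),
      coeFn_linearCombination_modL2 (p j) (mulL2 hw g), coeFn_mulL2 hw g] with x hsub hcomb hmul
    rw [hsub, Pi.sub_apply, hcomb, hmul, one_sub_mul]
  refine tendsto_Lp_zero_of_dominated ENNReal.ofNat_ne_top (g := g) (fun j => ?_) ?_
  · filter_upwards [hcoe, hle] with x hx hlex
    rw [hx, ← mul_assoc, norm_mul, norm_mul]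
    exact mul_le_of_le_one_left (norm_nonneg _) (hlex j)
  · filter_upwards [hcoe, hlim] with x hx hlimx
    simp only [hx]
    simpa using (hlimx.const_sub 1).mul_const (w x * g x)

/- The weight only has to dominate the supremum over `j` of `‖1 - trigPoly x (p j)‖`, which is
finite for almost every `x`. -/
theorem exists_farApprox_modL2_mulL2 (hg : ∀ᵐ x, g x ≠ 0) :
    ∃ (w : ℝ → ℂ) (hw : MemLp w ∞ volume), ∀ q, 2 < q → ∀ f,
      FarApprox (fun a => modL2 a (mulL2 hw g)) q f := by
  obtain ⟨p, hfar, hq, hlim⟩ := exists_trigPoly_tendsto_one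
  have hbdd : ∀ᵐ x : ℝ, BddAbove (Set.range fun j => ‖1 - trigPoly x (p j)‖) := by
    filter_upwards [hlim] with x hx
    exact (hx.const_sub 1).norm.bddAbove_range
  obtain ⟨w, hmeas, hw01, hle⟩ := exists_measurable_forall_mul_le_one
    (fun j => (continuous_const.sub (continuous_trigPoly (p j))).norm.measurable) hbdd
  have hnorm (x : ℝ) : ‖(w x : ℂ)‖ = w x := Complex.norm_of_nonneg (hw01 x).1.le
  have hw : MemLp (fun x => (w x : ℂ)) ∞ volume :=
    memLp_top_of_bound (Complex.measurable_ofReal.comp hmeas).aestronglyMeasurable 1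
      (Eventually.of_forall fun x => (hnorm x).trans_le (hw01 x).2)
  have hwg : ∀ᵐ x, mulL2 hw g x ≠ 0 := by
    filter_upwards [coeFn_mulL2 hw g, hg] with x hx hgx
    rw [hx]
    exact mul_ne_zero (Complex.ofReal_ne_zero.2 (hw01 x).1.ne') hgx
  have htend := tendsto_sub_linearCombination_modL2 (g := g) hw hlim (by simpa only [hnorm])
  exact ⟨_, hw, fun q hq2 f => FarApprox.of_span_topologicalClosure_eq_top (by linarith)
    (farApprox_modL2 hfar (hq q hq2) htend) (span_modL2_topologicalClosure_eq_top hwg) f⟩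

end TrigPolyModulation

section Translates

theorem exists_isQuasiFrame_translateL2 : ∃ Λ : ℕ → ℝ, IsUniformlyDiscrete Λ ∧
    ∃ g : Lp ℂ 2 (volume : Measure ℝ), IsQuasiFrame fun n => translateL2 (Λ n) g := by
  have hgauss : ∀ᵐ x, gaussL2 0 x ≠ 0 := by
    filter_upwards [coeFn_gaussL2 0] with x hx
    rw [hx, ← norm_pos_iff, norm_gaussianAt]
    exact Real.exp_pos _
  obtain ⟨w, hw, hfar⟩ := exists_farApprox_modL2_mulL2 hgauss
  have : Fact ((2 : ℝ≥0∞) ≠ ∞) := ⟨ENNReal.ofNat_ne_top⟩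
  obtain ⟨Λ, hΛ, hcomplete⟩ :=
    exists_isUniformlyDiscrete_isCompleteWithEstimate zero_le_two hfar
  obtain ⟨K, hK, hsum⟩ := hΛ.exists_sum_norm_inner_gaussL2_le
  have hbessel : IsBessel fun n => modL2 (Λ n) (mulL2 hw (gaussL2 0)) := by
    simpa only [Function.comp_def, modL2_mulL2_comm] using
      (IsBessel.of_sum_le hK (hsum 0)).map (mulL2 hw)
  exact ⟨Λ, hΛ, _, isQuasiFrame_translateL2_fourierInv ⟨hcomplete, hbessel⟩⟩

lemma IsUniformlyDiscrete.neg {ι : Type*} {Λ : ι → ℝ} (hΛ : IsUniformlyDiscrete Λ) :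
    IsUniformlyDiscrete fun n => -Λ n := by
  obtain ⟨δ, hδ, hsep⟩ := hΛ
  exact ⟨δ, hδ, fun m n hmn => by simpa only [neg_sub_neg] using hsep n m hmn.symm⟩

lemma tendsto_gaussianAt_natCast (x : ℝ) :
    Tendsto (fun N : ℕ => gaussianAt N x) atTop (𝓝 0) := by
  rw [tendsto_zero_iff_norm_tendsto_zero]
  simp only [norm_gaussianAt, neg_mul]
  have hsub : Tendsto (fun N : ℕ => x - (N : ℝ)) atTop atBot :=
    tendsto_const_nhds.add_atBot (tendsto_neg_atTop_atBot.comp tendsto_natCast_atTop_atTop)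
  have hsq : Tendsto (fun N : ℕ => (x - N) ^ 2) atTop atTop := by
    simpa only [sq] using hsub.atBot_mul_atBot₀ hsub
  exact Real.tendsto_exp_neg_atTop_nhds_zero.comp (hsq.const_mul_atTop pi_pos)

lemma tendsto_mulL2_gaussianAt_natCast (h : Lp ℂ 2 (volume : Measure ℝ)) :
    Tendsto (fun N : ℕ => mulL2 (memLp_top_gaussianAt N) h) atTop (𝓝 0) := by
  have hcoe := ae_all_iff.2 fun N : ℕ => coeFn_mulL2 (memLp_top_gaussianAt N) h
  refine tendsto_Lp_zero_of_dominated ENNReal.ofNat_ne_top (g := h) (fun N => ?_) ?_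
  · filter_upwards [hcoe] with x hx
    rw [hx, norm_mul]
    exact mul_le_of_le_one_left (norm_nonneg _) (norm_gaussianAt_le_one _ _)
  · filter_upwards [hcoe] with x hx
    simpa only [hx, zero_mul] using (tendsto_gaussianAt_natCast x).mul_const (h x)

lemma norm_sq_mulL2_gaussL2 (N : ℝ) :
    ‖mulL2 (memLp_top_gaussianAt N) (gaussL2 N)‖ ^ 2 = 1 / 2 := by
  have hnorm : ‖mulL2 (memLp_top_gaussianAt N) (gaussL2 N)‖ ^ 2 =
      ∫ x, rexp (-(4 * π) * (x - N) ^ 2) := by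
    rw [← inner_self_eq_norm_sq (𝕜 := ℂ), L2.inner_def, ← integral_re (L2.integrable_inner _ _)]
    refine integral_congr_ae ?_
    filter_upwards [coeFn_mulL2 (memLp_top_gaussianAt N) (gaussL2 N), coeFn_gaussL2 N] with x hx hG
    rw [hx, hG, inner_self_eq_norm_sq, norm_mul, norm_gaussianAt, ← Real.exp_add,
      ← Real.exp_nat_mul]
    push_cast
    ring_nf
  have hsqrt : √(π / (4 * π)) = 1 / 2 := by
    rw [div_mul_cancel_right₀ pi_ne_zero, Real.sqrt_eq_iff_mul_self_eq] <;> norm_num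
  rw [hnorm, integral_sub_right_eq_self fun x => rexp (-(4 * π) * x ^ 2), integral_gaussian, hsqrt]

lemma norm_inner_modL2_mulL2_gaussL2 (a N : ℝ) (h : Lp ℂ 2 (volume : Measure ℝ)) :
    ‖inner ℂ (modL2 a h) (mulL2 (memLp_top_gaussianAt N) (gaussL2 N))‖ =
      ‖inner ℂ (modL2 (-a) (gaussL2 N)) (mulL2 (memLp_top_gaussianAt N) h)‖ := by
  rw [inner_modL2_left, modL2_mulL2_comm, norm_inner_symm, inner_mulL2_left]
  simp only [star_gaussianAt]

theorem not_isHilbertFrame_translateL2 {ι : Type*} {Λ : ι → ℝ} (hΛ : IsUniformlyDiscrete Λ)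
    (g : Lp ℂ 2 (volume : Measure ℝ)) : ¬ IsHilbertFrame fun n => translateL2 (Λ n) g := by
  rintro ⟨A, B, hA, hframe⟩
  obtain ⟨K, -, hbessel⟩ := hΛ.neg.exists_sum_norm_inner_gaussL2_le
  have hle (N : ℕ) : A * (1 / 2) ≤ K * ‖mulL2 (memLp_top_gaussianAt N) (𝓕 g)‖ ^ 2 := by
    obtain ⟨hsum, hlower, -⟩ := hframe (𝓕⁻ (mulL2 (memLp_top_gaussianAt N) (gaussL2 N)))
    rw [← Lp.norm_fourier_eq, FourierTransform.fourier_fourierInv_eq, norm_sq_mulL2_gaussL2]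
      at hlower
    refine hlower.trans (hsum.tsum_le_of_sum_le fun s => ?_)
    simpa only [inner_translateL2, FourierTransform.fourier_fourierInv_eq,
      norm_inner_modL2_mulL2_gaussL2] using hbessel N (mulL2 (memLp_top_gaussianAt N) (𝓕 g)) s
  have hlim := ((tendsto_mulL2_gaussianAt_natCast (𝓕 g)).norm.pow 2).const_mul K
  rw [norm_zero, zero_pow two_ne_zero, mul_zero] at hlim
  exact (mul_pos hA one_half_pos).not_ge (ge_of_tendsto' hlim hle)

end Translates

end

/-- Some uniformly discrete sequence of translates of some `g ∈ L²(ℝ)` is a quasi-frame, whereas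
no uniformly discrete family of translates of any `g ∈ L²(ℝ)` is a frame. -/
theorem theorem1 :
    (∃ Λ : ℕ → ℝ, IsUniformlyDiscrete Λ ∧
      ∃ g : Lp ℂ 2 (volume : Measure ℝ), IsQuasiFrame (fun n => translateL2 (Λ n) g)) ∧
    (∀ (ι : Type) (Λ : ι → ℝ), IsUniformlyDiscrete Λ →
      ∀ g : Lp ℂ 2 (volume : Measure ℝ), ¬ IsHilbertFrame (fun n => translateL2 (Λ n) g)) :=
  ⟨exists_isQuasiFrame_translateL2, fun _ _ hΛ g => not_isHilbertFrame_translateL2 hΛ g⟩
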